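/- Let $m,n,d\ge 1$ be integers, $\rho$ a probability distribution on $[m]$, $\pi^b$ (behavioral) and $\pi$ (target) policies, i.e. for each $i\in[m]$, $\pi^b(\cdot|i)$ and $\pi(\cdot|i)$ are probability distributions on $[n]$, let $\psi:[m]\times[n]\to\mathbb{R}^d$, $(i,j)\mapsto\psi_{i,j}$, be a feature map, $\theta\in\mathbb{R}^d$, $\sigma\ge 0$ and $\delta\in(0,1)$. Put $$\Lambda=\sum_{i,j}\rho(i)\pi^b(j|i)\,\psi_{i,j}\psi_{i,j}^\top,\quad \psi_\pi=\sum_{i,j}\rho(i)\pi(j|i)\,\psi_{i,j},\quad v^\pi=\sum_{i,j}\rho(i)\pi(j|i)\,\psi_{i,j}^\top\theta=\psi_\pi^\top\theta,$$ and assume that $\Lambda$ is invertible. Write $\|x\|_A=\sqrt{x^\top A x}$, $L_\psi=\max_{i,j}\psi_{i,j}^\top\Lambda^{-1}\psi_{i,j}$, $L_\theta=\max_{i,j}|\psi_{i,j}^\top\theta|$, and let $\lambda_{\min}(\Lambda)$ be the smallest eigenvalue of $\Lambda$. Let $(i_t,j_t,r_t)_{1\le t\le T}$ be i.i.d. samples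 with $i_t\sim\rho$, $j_t\sim\pi^b(\cdot|i_t)$ and $r_t=\psi_{i_t,j_t}^\top\theta+\xi_t$, where the $\xi_t$ are i.i.d., independent of $(i_s,j_s)_{s\le T}$, and $\sigma$-subgaussian: $\mathbb{E}[e^{c\xi_t}]\le e^{c^2\sigma^2/2}$ for all $c\in\mathbb{R}$. For $\tau>0$ let $$\hat\theta=\Big(\sum_{t=1}^T\psi_{i_t,j_t}\psi_{i_t,j_t}^\top+\tau I_d\Big)^{-1}\sum_{t=1}^T r_t\psi_{i_t,j_t},\qquad \hat v=\hat\theta^\top\psi_\pi .$$ Assume $T\ge 18L_\psi\log(8d/\delta)$ and $0<\tau\le L_\psi\log(8d/\delta)\lambda_{\min}(\Lambda)$. Then, with probability at least $1-\delta$, $$|v^\pi-\hat v|\le\frac{E_1}{\sqrt T}+\frac{E_2}{T}+\frac{E_3}{T^{3/2}}+\frac{E_4}{T^2},$$ where $$E_1=\|\psi_\pi\|_{\Lambda^{-1}}\sqrt{2\sigma^2\log(8/\delta)},$$ $$E_2=\|\psi_\pi\|_{\Lambda^{-1}}\big(L_\psi L_\theta+\sigma(1+4\sqrt{2d})\sqrt{L_\psi}\big)\log\big(16(d+1)/\delta\big),$$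 $$E_3=\|\psi_\pi\|_{\Lambda^{-1}}\Big(\tfrac{\sigma\sqrt2}{3}+4\sigma\sqrt d+4\sqrt{L_\psi}L_\theta\Big)L_\psi\log^{3/2}\big(16(d+1)/\delta\big),$$ $$E_4=\|\psi_\pi\|_{\Lambda^{-1}}\tfrac{4\sigma\sqrt2}{3}\sqrt d\,L_\psi^{3/2}\log^2\big(16(d+1)/\delta\big).$$ In particular, there is a constant $C$ depending only on $m,n,d,\rho,\pi^b,\pi,\psi,\theta,\sigma,\delta$ (and not on $T$ or $\tau$) such that, for all such $T$ and $\tau$, with probability at least $1-\delta$, $$|v^\pi-\hat v|\le\|\psi_\pi\|_{\Lambda^{-1}}\sqrt{\frac{2\sigma^2\log(8/\delta)}{T}}+\frac{C}{T}.$$ -/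

import Mathlib

open MeasureTheory ProbabilityTheory
open scoped NNReal Matrix

noncomputable section

namespace LinearBandit

/-- The weights `ρ(i) p(j | i)` on context-arm pairs induced by a policy `p`. -/
def weight {m n : ℕ} (ρ : Fin m → ℝ) (p : Fin m → Fin n → ℝ) (i : Fin m) (j : Fin n) : ℝ :=
  ρ i * p i j

/-- `Λ = ∑ ω_{i,j} ψ_{i,j} ψ_{i,j}ᵀ`, with `ω` the weights of the behavioral policy `πb`. -/
def covMatrix {m n d : ℕ} (ρ : Fin m → ℝ) (πb : Fin m → Fin n → ℝ)
    (ψ : Fin m → Fin n → Fin d → ℝ) : Matrix (Fin d) (Fin d) ℝ :=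
  ∑ i, ∑ j, weight ρ πb i j • Matrix.vecMulVec (ψ i j) (ψ i j)

/-- `ψ_π = ∑ ω^π_{i,j} ψ_{i,j}`. -/
def meanFeature {m n d : ℕ} (ρ : Fin m → ℝ) (π : Fin m → Fin n → ℝ)
    (ψ : Fin m → Fin n → Fin d → ℝ) : Fin d → ℝ :=
  ∑ i, ∑ j, weight ρ π i j • ψ i j

/-- The value `v^π_θ = ∑ ω^π_{i,j} ψ_{i,j}ᵀ θ` of the policy `π`. -/
def policyValue {m n d : ℕ} (ρ : Fin m → ℝ) (π : Fin m → Fin n → ℝ)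
    (ψ : Fin m → Fin n → Fin d → ℝ) (θ : Fin d → ℝ) : ℝ :=
  ∑ i, ∑ j, weight ρ π i j * (ψ i j ⬝ᵥ θ)

/-- The weighted norm `‖x‖_A = √(xᵀ A x)`, for `A` positive semi-definite. -/
def wnorm {d : ℕ} (A : Matrix (Fin d) (Fin d) ℝ) (x : Fin d → ℝ) : ℝ :=
  √(x ⬝ᵥ A *ᵥ x)

/-- The smallest eigenvalue of a symmetric real matrix. -/
def lambdaMin {d : ℕ} (A : Matrix (Fin d) (Fin d) ℝ) : ℝ :=
  sInf (spectrum ℝ A)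

/-- `L_ψ = max_{i,j} ψ_{i,j}ᵀ Λ⁻¹ ψ_{i,j}`. -/
def Lfeat {m n d : ℕ} (ρ : Fin m → ℝ) (πb : Fin m → Fin n → ℝ)
    (ψ : Fin m → Fin n → Fin d → ℝ) : ℝ :=
  ⨆ q : Fin m × Fin n, ψ q.1 q.2 ⬝ᵥ (covMatrix ρ πb ψ)⁻¹ *ᵥ ψ q.1 q.2

/-- `L_θ = max_{i,j} |ψ_{i,j}ᵀ θ|`. -/
def Lparam {m n d : ℕ} (ψ : Fin m → Fin n → Fin d → ℝ) (θ : Fin d → ℝ) : ℝ :=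
  ⨆ q : Fin m × Fin n, |ψ q.1 q.2 ⬝ᵥ θ|

/-- The regularized least-squares estimator of `θ` from the data `(i_t, j_t, r_t)`. -/
def thetaHat {m n d T : ℕ} (ψ : Fin m → Fin n → Fin d → ℝ) (τ : ℝ)
    (i : Fin T → Fin m) (j : Fin T → Fin n) (r : Fin T → ℝ) : Fin d → ℝ :=
  ((∑ t, Matrix.vecMulVec (ψ (i t) (j t)) (ψ (i t) (j t))) +
    τ • (1 : Matrix (Fin d) (Fin d) ℝ))⁻¹ *ᵥ (∑ t, r t • ψ (i t) (j t))

/-- The plug-in estimator `v̂ = θ̂ᵀ ψ_π`. -/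
def valueHat {m n d T : ℕ} (ρ : Fin m → ℝ) (π : Fin m → Fin n → ℝ)
    (ψ : Fin m → Fin n → Fin d → ℝ) (τ : ℝ)
    (i : Fin T → Fin m) (j : Fin T → Fin n) (r : Fin T → ℝ) : ℝ :=
  thetaHat ψ τ i j r ⬝ᵥ meanFeature ρ π ψ

/-- `(i_t, j_t, r_t)`, `t < T`, are i.i.d. samples of the contextual linear bandit with parameter
`θ`: contexts `i_t ∼ ρ`, arms `j_t ∼ πb(· | i_t)`, rewards `r_t = ψ_{i_t,j_t}ᵀ θ + ξ_t`, where the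
noise `ξ_t` is i.i.d., `σ`-subgaussian and independent of the contexts and arms. -/
structure IsSample {m n d T : ℕ} (ρ : Fin m → ℝ) (πb : Fin m → Fin n → ℝ)
    (ψ : Fin m → Fin n → Fin d → ℝ) (θ : Fin d → ℝ) (σ : ℝ≥0)
    {Ω : Type*} [MeasurableSpace Ω] (P : Measure Ω)
    (i : Fin T → Ω → Fin m) (j : Fin T → Ω → Fin n) (r ξ : Fin T → Ω → ℝ) : Prop where
  measurable_context : ∀ t, Measurable (i t)
  measurable_arm : ∀ t, Measurable (j t)
  measurable_noise : ∀ t, Measurable (ξ t)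
  law_pair : ∀ t a b, P.real {ω | i t ω = a ∧ j t ω = b} = weight ρ πb a b
  indep_pairs : iIndepFun (fun t ω => (i t ω, j t ω)) P
  indep_noise : iIndepFun ξ P
  ident_noise : ∀ s t, IdentDistrib (ξ s) (ξ t) P P
  subgaussian_noise : ∀ t, HasSubgaussianMGF (ξ t) (σ ^ 2) P
  noise_indep_pairs : IndepFun (fun ω t => ξ t ω) (fun ω t => (i t ω, j t ω)) P
  reward_eq : ∀ t ω, r t ω = ψ (i t ω) (j t ω) ⬝ᵥ θ + ξ t ω

/-- `E₁ = N √(2 σ² log(8/δ))`, with `N` standing for `‖ψ_π‖_{Λ⁻¹}`. -/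
def E1 (N σ δ : ℝ) : ℝ :=
  N * √(2 * σ ^ 2 * Real.log (8 / δ))

/-- `E₂`, with `N = ‖ψ_π‖_{Λ⁻¹}`, `L = L_ψ`, `K = L_θ`. -/
def E2 (d : ℕ) (N L K σ δ : ℝ) : ℝ :=
  N * (L * K + σ * (1 + 4 * √(2 * d)) * √L) * Real.log (16 * (d + 1) / δ)

/-- `E₃`, with `N = ‖ψ_π‖_{Λ⁻¹}`, `L = L_ψ`, `K = L_θ`. -/
def E3 (d : ℕ) (N L K σ δ : ℝ) : ℝ :=
  N * (σ * √2 / 3 + 4 * σ * √d + 4 * √L * K) * L * Real.log (16 * (d + 1) / δ) ^ (3 / 2 : ℝ)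

/-- `E₄`, with `N = ‖ψ_π‖_{Λ⁻¹}`, `L = L_ψ`. -/
def E4 (d : ℕ) (N L σ δ : ℝ) : ℝ :=
  N * (4 * σ * √2 / 3) * √d * L ^ (3 / 2 : ℝ) * Real.log (16 * (d + 1) / δ) ^ 2

end LinearBandit

end

/-! Let `G` be the sum of the `ψ_t ψ_tᵀ` over the sample and `z = (G + τ I)⁻¹ ψ_π`. Then `v^π - v̂ =
τ (z ⬝ᵥ θ) - ∑ (ψ_t ⬝ᵥ z) ξ_t` (`policyValue_sub_valueHat_eq`). Since `z` depends on the contexts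
and arms only, the noise term is, given these, a fixed linear combination of independent
subgaussians, with variance proxy `σ² zᵀGz`.

Write `N = ‖ψ_π‖_{Λ⁻¹}`, `L = L_ψ`, `a = log(8d/δ)`, `ε = √(2La/T)`. On the event `G ≥ (1 - ε) T Λ`,
`ridge_bounds` gives `zᵀGz ≤ N² / ((1 - ε)T)` and `‖z‖_Λ ≤ N / ((1 - ε)T)`, which control noise and
bias. The event fails with probability at most `d exp(-ε²T/(2L)) = δ/8`
(`covariance_matrix_chernoff`), and the noise tail costs `δ/4`. As `T ≥ 18La` means `ε ≤ 1/3`, the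
factors `1/(1 - ε)` and `1/√(1 - ε)` are at most `1 + 3ε/2`: the leading noise term is exactly
`E1/√T`, and the corrections fit into `E2` and `E3`.

The Chernoff bound is the matrix Laplace transform method. Whitening makes the covariance the
identity, so Golden–Thompson (`trace_exp_add_le`) peels off one sample at a time at the cost of a
scalar factor. Golden–Thompson itself follows from a trace inequality for powers of two and the
Lie–Trotter formula. -/

namespace LinearBandit

/-! ### Trace inequalities for powers of matrices. -/

section MatrixInequalities

variable {ι : Type*} [Fintype ι]

theorem trace_mul_transpose_self_nonneg (M : Matrix ι ι ℝ) : 0 ≤ (M * Mᵀ).trace := by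
  simp only [Matrix.trace, Matrix.diag, Matrix.mul_apply, Matrix.transpose_apply]
  exact Finset.sum_nonneg fun i _ => Finset.sum_nonneg fun j _ => mul_self_nonneg _

/-- Polarized form of the Cauchy–Schwarz inequality for the Frobenius inner product. -/
theorem two_mul_trace_mul_le (X Y : Matrix ι ι ℝ) :
    2 * (X * Y).trace ≤ (X * Xᵀ).trace + (Yᵀ * Y).trace := by
  have h := trace_mul_transpose_self_nonneg (X - Yᵀ)
  have h2 : (Yᵀ * Xᵀ).trace = (X * Y).trace := by
    rw [← Matrix.transpose_mul, Matrix.trace_transpose]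
  simp only [Matrix.transpose_sub, Matrix.transpose_transpose, sub_mul, mul_sub,
    Matrix.trace_sub] at h
  linarith

variable [DecidableEq ι]

theorem trace_mul_pow_comm (X Y : Matrix ι ι ℝ) (k : ℕ) :
    ((X * Y) ^ k).trace = ((Y * X) ^ k).trace := by
  cases k with
  | zero => simp
  | succ k =>
    rw [pow_succ', mul_assoc, Matrix.trace_mul_comm, pow_succ]
    congr 1
    have : Y * (X * Y) ^ k = (Y * X) ^ k * Y := by
      induction k with
      | zero => simp
      | succ k ih => rw [pow_succ, ← mul_assoc, ih, pow_succ]; simp only [mul_assoc]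
    rw [this, mul_assoc]

/-- The two bounds feed each other, hence the joint induction. The first, for `M ^ 2`, becomes by
cyclicity a statement about the symmetric matrices `M * Mᵀ` and `Mᵀ * M`, settled by the second and
Cauchy–Schwarz, as their powers have equal traces. The second comes from the first for `X * Y` and
then the second for `X ^ 2`, `Y ^ 2`. -/
theorem trace_pow_two_pow_le_aux (k : ℕ) :
    (∀ M : Matrix ι ι ℝ, (M ^ 2 ^ (k + 1)).trace ≤ ((M * Mᵀ) ^ 2 ^ k).trace) ∧
    (∀ X Y : Matrix ι ι ℝ, Xᵀ = X → Yᵀ = Y →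
      ((X * Y) ^ 2 ^ k).trace ≤ (X ^ 2 ^ k * Y ^ 2 ^ k).trace) := by
  induction k with
  | zero =>
    refine ⟨fun M => ?_, fun X Y _ _ => by simp⟩
    have h := two_mul_trace_mul_le M M
    have h2 : (Mᵀ * M).trace = (M * Mᵀ).trace := Matrix.trace_mul_comm _ _
    simp only [zero_add, pow_one, pow_zero, pow_two] at *
    linarith
  | succ k ih =>
    obtain ⟨ih1, ih2⟩ := ih
    constructor
    · intro M
      have h1 := ih1 (M ^ 2)
      rw [← pow_mul, ← pow_succ'] at h1
      refine h1.trans ?_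
      have e1 : M ^ 2 * (M ^ 2)ᵀ = M * (M * Mᵀ * Mᵀ) := by
        simp only [pow_two, Matrix.transpose_mul, mul_assoc]
      have e2 : M * Mᵀ * Mᵀ * M = (M * Mᵀ) * (Mᵀ * M) := by simp only [mul_assoc]
      rw [e1, trace_mul_pow_comm, e2]
      have s1 : (M * Mᵀ)ᵀ = M * Mᵀ := by simp
      have s2 : (Mᵀ * M)ᵀ = Mᵀ * M := by simp
      refine (ih2 _ _ s1 s2).trans ?_
      have h3 := two_mul_trace_mul_le ((M * Mᵀ) ^ 2 ^ k) ((Mᵀ * M) ^ 2 ^ k)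
      rw [Matrix.transpose_pow, Matrix.transpose_pow, s1, s2, ← pow_add, ← pow_add, ← two_mul,
        ← pow_succ', trace_mul_pow_comm Mᵀ M] at h3
      linarith
    · intro X Y hX hY
      refine (ih1 (X * Y)).trans ?_
      have e1 : X * Y * (X * Y)ᵀ = X * (Y ^ 2 * X) := by
        simp only [pow_two, Matrix.transpose_mul, mul_assoc, hX, hY]
      have e2 : Y ^ 2 * X * X = Y ^ 2 * X ^ 2 := by simp only [pow_two, mul_assoc]
      rw [e1, trace_mul_pow_comm, e2, trace_mul_pow_comm]
      refine (ih2 (X ^ 2) (Y ^ 2) ?_ ?_).trans (le_of_eq ?_)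
      · rw [Matrix.transpose_pow, hX]
      · rw [Matrix.transpose_pow, hY]
      · rw [← pow_mul, ← pow_mul, ← pow_succ']

/-- For symmetric matrices, `tr (XY)^(2^k) ≤ tr X^(2^k) Y^(2^k)`. -/
theorem trace_mul_pow_two_pow_le {X Y : Matrix ι ι ℝ} (hX : Xᵀ = X) (hY : Yᵀ = Y) (k : ℕ) :
    ((X * Y) ^ 2 ^ k).trace ≤ (X ^ 2 ^ k * Y ^ 2 ^ k).trace :=
  (trace_pow_two_pow_le_aux k).2 X Y hX hY

end MatrixInequalities

/-! ### The Lie–Trotter product formula. -/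

section LieTrotter

variable {𝔸 : Type*} [NormedRing 𝔸] [NormOneClass 𝔸]

open NormedSpace Filter Topology Asymptotics

theorem norm_pow_sub_pow_le {x y : 𝔸} {c : ℝ} (hx : ‖x‖ ≤ c) (hy : ‖y‖ ≤ c) (hc : 1 ≤ c) (k : ℕ) :
    ‖x ^ k - y ^ k‖ ≤ k * c ^ k * ‖x - y‖ := by
  induction k with
  | zero => simp
  | succ k ih =>
    have hc0 : 0 ≤ c := by linarith
    have e : x ^ (k + 1) - y ^ (k + 1) = x ^ k * (x - y) + (x ^ k - y ^ k) * y := by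
      rw [pow_succ, pow_succ]; noncomm_ring
    have hxk : ‖x ^ k‖ ≤ c ^ (k + 1) :=
      (norm_pow_le x k).trans ((pow_le_pow_left₀ (norm_nonneg _) hx k).trans
        (pow_le_pow_right₀ hc (Nat.le_succ k)))
    calc ‖x ^ (k + 1) - y ^ (k + 1)‖ ≤ ‖x ^ k‖ * ‖x - y‖ + ‖x ^ k - y ^ k‖ * ‖y‖ := by
          rw [e]
          exact (norm_add_le _ _).trans (add_le_add (norm_mul_le _ _) (norm_mul_le _ _))
      _ ≤ c ^ (k + 1) * ‖x - y‖ + (k * c ^ k * ‖x - y‖) * c := by gcongr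
      _ = _ := by push_cast; ring

variable [NormedAlgebra ℝ 𝔸] [CompleteSpace 𝔸]

theorem norm_exp_le_exp_norm (x : 𝔸) : ‖exp x‖ ≤ Real.exp ‖x‖ := by
  refine (exp_series_hasSum_exp' (𝕂 := ℝ) x).norm_le_of_bounded
    (g := fun n : ℕ => ‖x‖ ^ n / n.factorial) ?_ fun n => ?_
  · rw [Real.exp_eq_exp_ℝ]
    exact expSeries_div_hasSum_exp ‖x‖
  · rw [norm_smul, norm_inv, Real.norm_natCast, div_eq_inv_mul]
    exact mul_le_mul_of_nonneg_left (norm_pow_le x n) (by positivity)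

/-- The Lie–Trotter product formula along powers of two. -/
theorem tendsto_exp_mul_exp_pow_two_pow (a b : 𝔸) :
    Tendsto (fun k : ℕ => (exp ((1 / 2 ^ k : ℝ) • a) * exp ((1 / 2 ^ k : ℝ) • b)) ^ 2 ^ k) atTop
      (𝓝 (exp (a + b))) := by
  set s : ℕ → ℝ := fun k => 1 / 2 ^ k with hs
  have hs0 : ∀ k, 0 < s k := fun k => by positivity
  have hsm : ∀ k, (2 : ℝ) ^ k * s k = 1 := fun k => by simp [hs]
  have hst : Tendsto s atTop (𝓝 0) := by
    simpa [hs, one_div, Function.comp_def] using tendsto_inv_atTop_zero.comp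
      (tendsto_pow_atTop_atTop_of_one_lt (one_lt_two : (1 : ℝ) < 2))
  have hd : ∀ x : 𝔸, HasDerivAt (fun h : ℝ => exp (h • x)) x 0 := fun x => by
    simpa using hasDerivAt_exp_smul_const (𝕂 := ℝ) x 0
  -- The two curves agree to first order at `0`, so one factor errs by `o(2⁻ᵏ)`, and `2ᵏ` factors
  -- together by `o(1)`.
  have hD : HasDerivAt (fun h : ℝ => exp (h • a) * exp (h • b) - exp (h • (a + b))) 0 0 := by
    have := ((hd a).mul (hd b)).sub (hd (a + b))
    simp only [zero_smul, exp_zero, mul_one, one_mul, sub_self] at this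
    exact this
  have hlo := (hD.isLittleO).comp_tendsto hst
  simp only [zero_smul, exp_zero, mul_one, sub_self, sub_zero, smul_zero] at hlo
  set c : ℝ := ‖a‖ + ‖b‖ with hc
  let _ : NormedAlgebra ℚ 𝔸 := NormedAlgebra.restrictScalars ℚ ℝ 𝔸
  have hF : ∀ k, exp (s k • (a + b)) ^ 2 ^ k = exp (a + b) := fun k => by
    rw [← exp_nsmul, ← Nat.cast_smul_eq_nsmul ℝ, smul_smul]
    push_cast
    rw [hsm, one_smul]
  have hbound : ∀ k, ‖(exp (s k • a) * exp (s k • b)) ^ 2 ^ k - exp (a + b)‖ ≤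
      Real.exp c * (2 ^ k * ‖exp (s k • a) * exp (s k • b) - exp (s k • (a + b))‖) := fun k => by
    have n1 : ‖exp (s k • a) * exp (s k • b)‖ ≤ Real.exp (s k * c) := by
      refine (norm_mul_le _ _).trans ?_
      rw [hc, mul_add, Real.exp_add]
      have := fun x : 𝔸 => norm_exp_le_exp_norm (s k • x)
      simp only [norm_smul, Real.norm_of_nonneg (hs0 k).le] at this
      exact mul_le_mul (this a) (this b) (norm_nonneg _) (Real.exp_nonneg _)
    have n2 : ‖exp (s k • (a + b))‖ ≤ Real.exp (s k * c) := by
      refine (norm_exp_le_exp_norm _).trans (Real.exp_le_exp.2 ?_)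
      rw [norm_smul, Real.norm_of_nonneg (hs0 k).le]
      exact mul_le_mul_of_nonneg_left (norm_add_le _ _) (hs0 k).le
    have h := norm_pow_sub_pow_le n1 n2
      (Real.one_le_exp (mul_nonneg (hs0 k).le (by positivity))) (2 ^ k)
    rw [hF, ← Real.exp_nat_mul] at h
    push_cast at h
    rw [← mul_assoc, hsm, one_mul] at h
    linarith
  rw [tendsto_iff_norm_sub_tendsto_zero]
  refine squeeze_zero (fun _ => norm_nonneg _) hbound ?_
  rw [show (0 : ℝ) = Real.exp c * 0 by simp]
  refine Tendsto.const_mul _ ?_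
  have h2 := (isLittleO_iff_tendsto' (Eventually.of_forall fun k hk =>
    absurd hk (norm_ne_zero_iff.2 (hs0 k).ne'))).1 hlo.norm_norm
  refine h2.congr fun k => ?_
  rw [Real.norm_of_nonneg (hs0 k).le, div_eq_iff (hs0 k).ne', mul_right_comm, hsm, one_mul]
  rfl

end LieTrotter

/-! ### The Golden–Thompson inequality. -/

section GoldenThompson

variable {ι : Type*} [Fintype ι] [DecidableEq ι]

open NormedSpace Filter Topology

attribute [local instance] Matrix.linftyOpNormedRing Matrix.linftyOpNormedAlgebra

/-- The **Golden–Thompson inequality** for real symmetric matrices. -/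
theorem trace_exp_add_le {A B : Matrix ι ι ℝ} (hA : A.IsSymm) (hB : B.IsSymm) :
    (exp (A + B)).trace ≤ (exp A * exp B).trace := by
  cases isEmpty_or_nonempty ι
  · simp [Matrix.trace]
  have := Matrix.linfty_opNormOneClass (n := ι) (α := ℝ)
  have h := tendsto_exp_mul_exp_pow_two_pow A B
  have ht : Continuous (fun M : Matrix ι ι ℝ => M.trace) := continuous_id.matrix_trace
  refine le_of_tendsto ((ht.tendsto _).comp h) (Eventually.of_forall fun k => ?_)
  have e : ∀ C : Matrix ι ι ℝ, exp ((1 / 2 ^ k : ℝ) • C) ^ 2 ^ k = exp C := fun C => by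
    rw [← Matrix.exp_nsmul, ← Nat.cast_smul_eq_nsmul ℝ, smul_smul]
    simp
  have h1 := trace_mul_pow_two_pow_le (X := exp ((1 / 2 ^ k : ℝ) • A))
    (Y := exp ((1 / 2 ^ k : ℝ) • B)) (hA.smul _).exp (hB.smul _).exp k
  rwa [e, e] at h1

end GoldenThompson

/-! ### Spectral tools and the matrix Chernoff bound in the isotropic case. -/

section MatrixChernoff

open NormedSpace

theorem isSymm_vecMulVec_self {ι : Type*} (x : ι → ℝ) : (Matrix.vecMulVec x x).IsSymm := by
  ext i j; simp [Matrix.vecMulVec_apply, mul_comm]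

variable {ι : Type*} [Fintype ι]

theorem trace_mul_vecMulVec (A : Matrix ι ι ℝ) (x : ι → ℝ) :
    (A * Matrix.vecMulVec x x).trace = x ⬝ᵥ A *ᵥ x := by
  rw [Matrix.mul_vecMulVec, Matrix.trace_vecMulVec, dotProduct_comm]

theorem dotProduct_vecMulVec_mulVec (x v : ι → ℝ) :
    v ⬝ᵥ Matrix.vecMulVec x x *ᵥ v = (x ⬝ᵥ v) ^ 2 := by
  rw [Matrix.vecMulVec_mulVec, dotProduct_smul]
  simp [dotProduct_comm v x, pow_two]

variable [DecidableEq ι]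

theorem exists_orthogonal_diagonalization {H : Matrix ι ι ℝ} (hH : H.IsSymm) :
    ∃ (U : Matrix ι ι ℝ) (e : ι → ℝ), U * Uᵀ = 1 ∧ Uᵀ * U = 1 ∧
      H = U * Matrix.diagonal e * Uᵀ ∧ ∀ i, e i ∈ spectrum ℝ H := by
  have hh : H.IsHermitian := by
    rw [Matrix.IsHermitian, Matrix.conjTranspose_eq_transpose_of_trivial]; exact hH
  have hst : ∀ M : Matrix ι ι ℝ, star M = Mᵀ := fun M => by
    rw [Matrix.star_eq_conjTranspose, Matrix.conjTranspose_eq_transpose_of_trivial]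
  refine ⟨hh.eigenvectorUnitary, hh.eigenvalues, ?_, ?_, ?_, hh.eigenvalues_mem_spectrum_real⟩
  · rw [← hst]; exact Unitary.coe_mul_star_self hh.eigenvectorUnitary
  · rw [← hst]; exact Unitary.coe_star_mul_self hh.eigenvectorUnitary
  · rw [← hst]
    have := hh.spectral_theorem
    rw [Unitary.conjStarAlgAut_apply] at this
    exact this

theorem dotProduct_conj_diagonal_mulVec (U : Matrix ι ι ℝ) (e v : ι → ℝ) :
    v ⬝ᵥ (U * Matrix.diagonal e * Uᵀ) *ᵥ v = ∑ i, e i * (Uᵀ *ᵥ v) i ^ 2 := by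
  rw [← Matrix.mulVec_mulVec, ← Matrix.mulVec_mulVec, Matrix.dotProduct_mulVec,
    ← Matrix.mulVec_transpose, dotProduct]
  refine Finset.sum_congr rfl fun i _ => ?_
  rw [Matrix.mulVec_diagonal]; ring

theorem dotProduct_self_orthogonal {U : Matrix ι ι ℝ} (hU : U * Uᵀ = 1) (v : ι → ℝ) :
    v ⬝ᵥ v = ∑ i, (Uᵀ *ᵥ v) i ^ 2 := by
  have h := dotProduct_conj_diagonal_mulVec U (fun _ => 1) v
  simpa [hU] using h

theorem mul_dotProduct_le_of_forall_spectrum_ge {H : Matrix ι ι ℝ} (hH : H.IsSymm) {μ : ℝ}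
    (h : ∀ a ∈ spectrum ℝ H, μ ≤ a) (v : ι → ℝ) : μ * (v ⬝ᵥ v) ≤ v ⬝ᵥ H *ᵥ v := by
  obtain ⟨U, e, hU, -, rfl, he⟩ := exists_orthogonal_diagonalization hH
  rw [dotProduct_conj_diagonal_mulVec, dotProduct_self_orthogonal hU, Finset.mul_sum]
  exact Finset.sum_le_sum fun i _ => mul_le_mul_of_nonneg_right (h _ (he i)) (sq_nonneg _)

/-- Some eigenvalue must exceed `μ`, and its exponential is one of the positive summands of the
trace. This is the Markov step of the Laplace transform method: a violated quadratic form bound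
makes the trace large. -/
theorem exp_le_trace_exp {H : Matrix ι ι ℝ} (hH : H.IsSymm) {μ : ℝ} {v : ι → ℝ}
    (hv : μ * (v ⬝ᵥ v) < v ⬝ᵥ H *ᵥ v) : Real.exp μ ≤ (exp H).trace := by
  obtain ⟨U, e, hU, hU', rfl, he⟩ := exists_orthogonal_diagonalization hH
  obtain ⟨i, hi⟩ : ∃ i, μ < e i := by
    by_contra! hc
    refine hv.not_ge ?_
    rw [dotProduct_conj_diagonal_mulVec, dotProduct_self_orthogonal hU, Finset.mul_sum]
    exact Finset.sum_le_sum fun i _ => mul_le_mul_of_nonneg_right (hc i) (sq_nonneg _)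
  have hinv : Uᵀ = U⁻¹ := (Matrix.inv_eq_right_inv hU).symm
  have hunit : IsUnit U := IsUnit.of_mul_eq_one _ hU
  have htr : (exp (U * Matrix.diagonal e * Uᵀ)).trace = ∑ i, Real.exp (e i) := by
    rw [hinv, Matrix.exp_conj U _ hunit, Matrix.exp_diagonal, ← hinv, Matrix.trace_mul_cycle, hU',
      one_mul, Matrix.trace_diagonal]
    simp [Pi.coe_exp, Real.exp_eq_exp_ℝ]
  rw [htr]
  exact (Real.exp_le_exp.2 hi.le).trans
    (Finset.single_le_sum (f := fun i => Real.exp (e i)) (fun _ _ => (Real.exp_pos _).le)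
      (Finset.mem_univ i))

theorem dotProduct_exp_mulVec_nonneg {A : Matrix ι ι ℝ} (hA : A.IsSymm) (v : ι → ℝ) :
    0 ≤ v ⬝ᵥ exp A *ᵥ v := by
  have hh : exp A = (exp ((1 / 2 : ℝ) • A))ᵀ * exp ((1 / 2 : ℝ) • A) := by
    rw [(hA.smul _).exp.eq, ← Matrix.exp_add_of_commute _ _ (Commute.refl _), ← add_smul]
    norm_num
  rw [hh, ← Matrix.mulVec_mulVec, Matrix.dotProduct_mulVec, Matrix.vecMul_transpose]
  exact Finset.sum_nonneg fun i _ => mul_self_nonneg _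

theorem trace_exp_nonneg {A : Matrix ι ι ℝ} (hA : A.IsSymm) : 0 ≤ (exp A).trace := by
  refine Finset.sum_nonneg fun i _ => ?_
  have := dotProduct_exp_mulVec_nonneg hA (Pi.single i 1)
  simpa using this

section

attribute [local instance] Matrix.linftyOpNormedRing Matrix.linftyOpNormedAlgebra

theorem exp_smul_vecMulVec (x : ι → ℝ) (t : ℝ) (hx : x ⬝ᵥ x ≠ 0) :
    exp (t • Matrix.vecMulVec x x) =
      1 + ((Real.exp (t * (x ⬝ᵥ x)) - 1) / (x ⬝ᵥ x)) • Matrix.vecMulVec x x := by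
  set c := x ⬝ᵥ x
  set X := Matrix.vecMulVec x x with hX
  have hXX : X * X = c • X := by
    rw [hX, Matrix.vecMulVec_mul_vecMulVec, Matrix.vecMulVec_smul]
  -- Since `X * X = c • X`, the powers are geometric except at `n = 0`; the last summand corrects
  -- that term.
  have hpow : ∀ n : ℕ, X ^ n = (c ^ n * c⁻¹) • X + if n = 0 then 1 - c⁻¹ • X else 0 := by
    intro n
    cases n with
    | zero => simp
    | succ n =>
      have : ∀ n : ℕ, X ^ (n + 1) = c ^ n • X := fun n => by
        induction n with
        | zero => simp
        | succ n ih => rw [pow_succ, ih, smul_mul_assoc, hXX, smul_smul, pow_succ]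
      rw [this, if_neg (Nat.succ_ne_zero n), add_zero, pow_succ, mul_assoc, mul_inv_cancel₀ hx,
        mul_one]
  have h1 := exp_series_hasSum_exp' (𝕂 := ℝ) (t • X)
  have h2 : HasSum (fun n : ℕ => ((t * c) ^ n / (n.factorial : ℝ)) • (c⁻¹ • X))
      (Real.exp (t * c) • (c⁻¹ • X)) := by
    rw [Real.exp_eq_exp_ℝ]
    exact (expSeries_div_hasSum_exp (t * c)).smul_const _
  have h3 : HasSum (fun n : ℕ => if n = 0 then (1 : Matrix ι ι ℝ) - c⁻¹ • X else 0)
      (1 - c⁻¹ • X) := hasSum_ite_eq 0 _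
  have h4 := h1.unique ((h2.add h3).congr_fun ?_)
  · refine h4.trans ?_
    rw [sub_div, sub_smul, smul_smul, div_eq_mul_inv, one_div]
    abel
  · intro n
    rw [smul_pow, hpow]
    cases n with
    | zero => simp
    | succ n =>
      simp only [Nat.succ_ne_zero, if_false, add_zero, smul_smul]
      congr 1
      rw [mul_pow]; ring

end

theorem exists_exp_neg_smul_vecMulVec_eq {x : ι → ℝ} {l L : ℝ} (hl : 0 ≤ l) (hx : x ⬝ᵥ x ≤ L) :
    ∃ κ, l - l ^ 2 * L / 2 ≤ κ ∧
      exp (-(l • Matrix.vecMulVec x x)) = 1 - κ • Matrix.vecMulVec x x := by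
  have hx0 : 0 ≤ x ⬝ᵥ x := Finset.sum_nonneg fun i _ => mul_self_nonneg _
  rcases hx0.eq_or_lt with h0 | h0
  · have : x = 0 := dotProduct_self_eq_zero.1 h0.symm
    subst this
    refine ⟨l, ?_, by simp⟩
    have : 0 ≤ L := hx0.trans hx
    have : 0 ≤ l ^ 2 * L / 2 := by positivity
    linarith
  · refine ⟨(1 - Real.exp (-l * (x ⬝ᵥ x))) / (x ⬝ᵥ x), ?_, ?_⟩
    · rw [le_div_iff₀ h0]
      have hy : 0 ≤ l * (x ⬝ᵥ x) := mul_nonneg hl h0.le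
      have h1 : Real.exp (-(l * (x ⬝ᵥ x))) ≤ 1 - l * (x ⬝ᵥ x) + (l * (x ⬝ᵥ x)) ^ 2 / 2 := by
        have h2 := Real.quadratic_le_exp_of_nonneg hy
        rw [Real.exp_neg, inv_le_iff_one_le_mul₀ (Real.exp_pos _)]
        generalize l * (x ⬝ᵥ x) = y at *
        have h3 : 0 ≤ 1 - y + y ^ 2 / 2 := by nlinarith [sq_nonneg (y - 1)]
        -- `(1 - y + y²/2)(1 + y + y²/2) = 1 + y⁴/4 ≥ 1`.
        refine le_trans ?_ (mul_le_mul_of_nonneg_left h2 h3)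
        nlinarith [sq_nonneg (y ^ 2)]
      rw [neg_mul]
      have : (l ^ 2 * (x ⬝ᵥ x)) * (x ⬝ᵥ x) ≤ (l ^ 2 * (x ⬝ᵥ x)) * L :=
        mul_le_mul_of_nonneg_left hx (by positivity)
      nlinarith
    · rw [← neg_smul, exp_smul_vecMulVec x _ h0.ne', sub_eq_add_neg 1 (_ • _), ← neg_smul]
      congr 2
      ring

variable {Q : Type*} [Fintype Q] {w : Q → ℝ} {x : Q → ι → ℝ} {l L : ℝ}

/-- Golden–Thompson splits off the rank-one exponential, which is affine in `vecMulVec (x q) (x q)`.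
Averaging replaces that matrix by the identity, leaving the scalar `1 - g ≤ exp (-g)`. -/
theorem sum_trace_exp_sub_le (hw : ∀ q, 0 ≤ w q) (hw1 : ∑ q, w q = 1)
    (hx : ∀ q, x q ⬝ᵥ x q ≤ L) (hcov : ∑ q, w q • Matrix.vecMulVec (x q) (x q) = 1) (hl : 0 ≤ l)
    {A : Matrix ι ι ℝ} (hA : A.IsSymm) :
    ∑ q, w q * (exp (A - l • Matrix.vecMulVec (x q) (x q))).trace ≤
      Real.exp (-(l - l ^ 2 * L / 2)) * (exp A).trace := by
  set g := l - l ^ 2 * L / 2 with hg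
  have h1 : ∀ q, w q * (exp (A - l • Matrix.vecMulVec (x q) (x q))).trace ≤
      w q * (exp A).trace - g * (exp A * (w q • Matrix.vecMulVec (x q) (x q))).trace := fun q => by
    obtain ⟨κ, hκ, he⟩ := exists_exp_neg_smul_vecMulVec_eq hl (hx q)
    have h2 := trace_exp_add_le hA ((isSymm_vecMulVec_self (x q)).smul l).neg
    rw [← sub_eq_add_neg, he, mul_sub, mul_one, Matrix.trace_sub, mul_smul_comm,
      Matrix.trace_smul, trace_mul_vecMulVec, smul_eq_mul] at h2
    rw [mul_smul_comm, Matrix.trace_smul, trace_mul_vecMulVec, smul_eq_mul]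
    have h3 := dotProduct_exp_mulVec_nonneg hA (x q)
    have h4 := mul_le_mul_of_nonneg_left (h2.trans
      (sub_le_sub_left (mul_le_mul_of_nonneg_right hκ h3) _)) (hw q)
    rw [← hg] at h4
    linarith
  refine (Finset.sum_le_sum fun q _ => h1 q).trans ?_
  rw [Finset.sum_sub_distrib, ← Finset.sum_mul, hw1, ← Finset.mul_sum, ← Matrix.trace_sum,
    ← Finset.mul_sum, hcov, mul_one, one_mul]
  have h5 := mul_le_mul_of_nonneg_right (Real.one_sub_le_exp_neg g) (trace_exp_nonneg hA)
  linarith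

theorem sum_prod_trace_exp_sub_le (hw : ∀ q, 0 ≤ w q) (hw1 : ∑ q, w q = 1)
    (hx : ∀ q, x q ⬝ᵥ x q ≤ L) (hcov : ∑ q, w q • Matrix.vecMulVec (x q) (x q) = 1) (hl : 0 ≤ l)
    (T : ℕ) {A : Matrix ι ι ℝ} (hA : A.IsSymm) :
    ∑ q : Fin T → Q, (∏ t, w (q t)) *
        (exp (A - l • ∑ t, Matrix.vecMulVec (x (q t)) (x (q t)))).trace ≤
      Real.exp (-(l - l ^ 2 * L / 2) * T) * (exp A).trace := by
  induction T generalizing A with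
  | zero => simp
  | succ T ih =>
    have hsum : ∑ q : Fin (T + 1) → Q, (∏ t, w (q t)) *
        (exp (A - l • ∑ t, Matrix.vecMulVec (x (q t)) (x (q t)))).trace =
        ∑ p : Q, w p * ∑ q : Fin T → Q, (∏ t, w (q t)) *
          (exp ((A - l • Matrix.vecMulVec (x p) (x p)) -
            l • ∑ t, Matrix.vecMulVec (x (q t)) (x (q t)))).trace := by
      rw [← (Fin.consEquiv fun _ => Q).sum_comp, Fintype.sum_prod_type]
      refine Finset.sum_congr rfl fun p _ => ?_
      rw [Finset.mul_sum]
      refine Finset.sum_congr rfl fun q _ => ?_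
      simp only [Fin.consEquiv_apply, Fin.prod_univ_succ, Fin.sum_univ_succ, Fin.cons_zero,
        Fin.cons_succ, smul_add, sub_sub, mul_assoc]
    rw [hsum]
    calc _ ≤ ∑ p : Q, w p * (Real.exp (-(l - l ^ 2 * L / 2) * T) *
            (exp (A - l • Matrix.vecMulVec (x p) (x p))).trace) :=
          Finset.sum_le_sum fun p _ => mul_le_mul_of_nonneg_left
            (ih (hA.sub ((isSymm_vecMulVec_self (x p)).smul l))) (hw p)
      _ = Real.exp (-(l - l ^ 2 * L / 2) * T) *
            ∑ p : Q, w p * (exp (A - l • Matrix.vecMulVec (x p) (x p))).trace := by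
          rw [Finset.mul_sum]
          exact Finset.sum_congr rfl fun p _ => by ring
      _ ≤ Real.exp (-(l - l ^ 2 * L / 2) * T) *
            (Real.exp (-(l - l ^ 2 * L / 2)) * (exp A).trace) :=
          mul_le_mul_of_nonneg_left (sum_trace_exp_sub_le hw hw1 hx hcov hl hA)
            (Real.exp_nonneg _)
      _ = _ := by
          rw [← mul_assoc, ← Real.exp_add]
          push_cast
          ring_nf

open Classical in
/-- The lower tail of the **matrix Chernoff bound** for i.i.d. isotropic vectors with finitely many
values. -/
theorem isotropic_matrix_chernoff (hw : ∀ q, 0 ≤ w q) (hw1 : ∑ q, w q = 1)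
    (hx : ∀ q, x q ⬝ᵥ x q ≤ L) (hcov : ∑ q, w q • Matrix.vecMulVec (x q) (x q) = 1) (hL : 0 < L)
    {ε : ℝ} (hε : 0 < ε) (T : ℕ) :
    ∑ q : Fin T → Q with ¬ ∀ v : ι → ℝ, (1 - ε) * T * (v ⬝ᵥ v) ≤ ∑ t, (x (q t) ⬝ᵥ v) ^ 2,
      ∏ t, w (q t) ≤ Fintype.card ι * Real.exp (-(ε ^ 2 * T / (2 * L))) := by
  -- This `l` minimizes the final exponent `(l² L / 2 - l ε) T`.
  set l := ε / L with hl
  have hl1 : 0 < l := by positivity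
  set S : (Fin T → Q) → Matrix ι ι ℝ := fun q => ∑ t, Matrix.vecMulVec (x (q t)) (x (q t)) with hS
  have hSsymm : ∀ q, (S q).IsSymm := fun q => by
    rw [Matrix.IsSymm, hS, Matrix.transpose_sum]
    exact Finset.sum_congr rfl fun t _ => isSymm_vecMulVec_self _
  have hexpS : ∀ q, ((0 : Matrix ι ι ℝ) - l • S q).IsSymm := fun q =>
    Matrix.isSymm_zero.sub ((hSsymm q).smul l)
  have hSv : ∀ q (v : ι → ℝ), v ⬝ᵥ S q *ᵥ v = ∑ t, (x (q t) ⬝ᵥ v) ^ 2 := fun q v => by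
    rw [hS, Matrix.sum_mulVec, dotProduct_sum]
    exact Finset.sum_congr rfl fun t _ => dotProduct_vecMulVec_mulVec _ _
  have hp : ∀ q : Fin T → Q, 0 ≤ ∏ t, w (q t) := fun q => Finset.prod_nonneg fun t _ => hw _
  have hmain := sum_prod_trace_exp_sub_le hw hw1 hx hcov hl1.le T (A := 0) Matrix.isSymm_zero
  rw [exp_zero, Matrix.trace_one] at hmain
  have hbad : ∀ q : Fin T → Q,
      (¬ ∀ v : ι → ℝ, (1 - ε) * T * (v ⬝ᵥ v) ≤ ∑ t, (x (q t) ⬝ᵥ v) ^ 2) →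
      Real.exp (-(l * ((1 - ε) * T))) ≤ (exp (0 - l • S q)).trace := fun q hq => by
    push Not at hq
    obtain ⟨v, hv⟩ := hq
    refine exp_le_trace_exp (hexpS q) (v := v) ?_
    rw [zero_sub, Matrix.neg_mulVec, dotProduct_neg, Matrix.smul_mulVec, dotProduct_smul, hSv,
      smul_eq_mul]
    have := mul_lt_mul_of_pos_left hv hl1
    linarith
  have h1 : Real.exp (-(l * ((1 - ε) * T))) *
      ∑ q : Fin T → Q with ¬ ∀ v : ι → ℝ, (1 - ε) * T * (v ⬝ᵥ v) ≤ ∑ t, (x (q t) ⬝ᵥ v) ^ 2,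
        ∏ t, w (q t) ≤ Real.exp (-(l - l ^ 2 * L / 2) * T) * Fintype.card ι := by
    refine le_trans ?_ hmain
    rw [Finset.mul_sum]
    refine (Finset.sum_le_sum fun q hq => ?_).trans
      (Finset.sum_le_sum_of_subset_of_nonneg (Finset.filter_subset _ _) fun q _ _ =>
        mul_nonneg (hp q) (trace_exp_nonneg (hexpS q)))
    rw [mul_comm]
    exact mul_le_mul_of_nonneg_left (hbad q (Finset.mem_filter.1 hq).2) (hp q)
  rw [Real.exp_neg, inv_mul_le_iff₀ (Real.exp_pos _), ← mul_assoc, ← Real.exp_add] at h1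
  refine h1.trans (le_of_eq ?_)
  rw [mul_comm]
  congr 2
  rw [hl]
  field_simp
  ring

end MatrixChernoff

/-! ### General covariance, reduced to the isotropic case by whitening. -/

section Covariance

variable {ι : Type*} [Fintype ι]

theorem dotProduct_mulVec_comm {M : Matrix ι ι ℝ} (hM : M.IsSymm) (v u : ι → ℝ) :
    v ⬝ᵥ M *ᵥ u = M *ᵥ v ⬝ᵥ u := by
  rw [Matrix.dotProduct_mulVec, ← Matrix.mulVec_transpose, hM.eq]

theorem dotProduct_transpose_mul_self_mulVec (B : Matrix ι ι ℝ) (u v : ι → ℝ) :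
    u ⬝ᵥ (Bᵀ * B) *ᵥ v = B *ᵥ u ⬝ᵥ B *ᵥ v := by
  rw [← Matrix.mulVec_mulVec, Matrix.dotProduct_mulVec, Matrix.vecMul_transpose]

theorem posSemidef_sum_smul_vecMulVec {Q : Type*} [Fintype Q] {w : Q → ℝ} {ψ : Q → ι → ℝ}
    (hw : ∀ q, 0 ≤ w q) :
    (∑ q, w q • Matrix.vecMulVec (ψ q) (ψ q)).PosSemidef := by
  refine Matrix.posSemidef_sum _ fun q _ => ?_
  have h := Matrix.posSemidef_vecMulVec_self_star (ψ q)
  rw [star_trivial] at h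
  exact h.smul (hw q)

variable [DecidableEq ι]

open scoped MatrixOrder Matrix.Norms.L2Operator in
theorem exists_isUnit_transpose_mul_self_eq {Λ : Matrix ι ι ℝ} (hΛ : Λ.PosSemidef)
    (hu : IsUnit Λ) : ∃ B : Matrix ι ι ℝ, IsUnit B ∧ Λ = Bᵀ * B := by
  obtain ⟨B, hB⟩ := CStarAlgebra.nonneg_iff_eq_star_mul_self.mp hΛ.nonneg
  rw [Matrix.star_eq_conjTranspose, Matrix.conjTranspose_eq_transpose_of_trivial] at hB
  refine ⟨B, ?_, hB⟩
  rw [hB] at hu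
  exact isUnit_of_mul_isUnit_right hu

theorem dotProduct_sq_le_of_posSemidef {Λ : Matrix ι ι ℝ} (hΛ : Λ.PosSemidef)
    (hu : IsUnit Λ) (u v : ι → ℝ) : (u ⬝ᵥ Λ *ᵥ v) ^ 2 ≤ (u ⬝ᵥ Λ *ᵥ u) * (v ⬝ᵥ Λ *ᵥ v) := by
  obtain ⟨B, -, rfl⟩ := exists_isUnit_transpose_mul_self_eq hΛ hu
  simp only [dotProduct_transpose_mul_self_mulVec]
  have := Finset.sum_mul_sq_le_sq_mul_sq Finset.univ (B *ᵥ u) (B *ᵥ v)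
  simpa only [dotProduct, pow_two] using this

theorem dotProduct_sq_le_inv {Λ : Matrix ι ι ℝ} (hΛ : Λ.PosSemidef)
    (hu : IsUnit Λ) (p z : ι → ℝ) : (p ⬝ᵥ z) ^ 2 ≤ (p ⬝ᵥ Λ⁻¹ *ᵥ p) * (z ⬝ᵥ Λ *ᵥ z) := by
  have hs : Λ.IsSymm := by
    have := hΛ.1
    rwa [Matrix.IsHermitian, Matrix.conjTranspose_eq_transpose_of_trivial] at this
  have hdet : IsUnit Λ.det := (Matrix.isUnit_iff_isUnit_det _).1 hu
  have h := dotProduct_sq_le_of_posSemidef hΛ hu (Λ⁻¹ *ᵥ p) z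
  have e : Λ *ᵥ Λ⁻¹ *ᵥ p = p := by
    rw [Matrix.mulVec_mulVec, Matrix.mul_nonsing_inv _ hdet, Matrix.one_mulVec]
  rwa [dotProduct_mulVec_comm hs, dotProduct_mulVec_comm hs (Λ⁻¹ *ᵥ p), e] at h

variable {Q : Type*} [Fintype Q] {w : Q → ℝ} {ψ : Q → ι → ℝ} {Λ : Matrix ι ι ℝ} {L : ℝ}

/-- The average of `ψ q ⬝ᵥ Λ⁻¹ *ᵥ ψ q` is the trace of `Λ⁻¹ * Λ`. This is what makes `Lfeat`
positive. -/
theorem card_le_of_covariance (hw : ∀ q, 0 ≤ w q) (hw1 : ∑ q, w q = 1)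
    (hΛ : Λ = ∑ q, w q • Matrix.vecMulVec (ψ q) (ψ q)) (hu : IsUnit Λ)
    (hL : ∀ q, ψ q ⬝ᵥ Λ⁻¹ *ᵥ ψ q ≤ L) : (Fintype.card ι : ℝ) ≤ L := by
  have hdet : IsUnit Λ.det := (Matrix.isUnit_iff_isUnit_det _).1 hu
  have h1 : (Λ⁻¹ * Λ).trace = ∑ q, w q * (ψ q ⬝ᵥ Λ⁻¹ *ᵥ ψ q) := by
    conv_lhs => rw [hΛ, Finset.mul_sum, Matrix.trace_sum]
    refine Finset.sum_congr rfl fun q _ => ?_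
    rw [mul_smul_comm, Matrix.trace_smul, trace_mul_vecMulVec, ← hΛ, smul_eq_mul]
  rw [Matrix.nonsing_inv_mul _ hdet, Matrix.trace_one] at h1
  rw [h1, ← one_mul L, ← hw1, Finset.sum_mul]
  exact Finset.sum_le_sum fun q _ => mul_le_mul_of_nonneg_left (hL q) (hw q)

open Classical in
/-- The lower tail of the matrix Chernoff bound for the empirical covariance of i.i.d. vectors with
finitely many values and covariance `Λ`. -/
theorem covariance_matrix_chernoff (hw : ∀ q, 0 ≤ w q) (hw1 : ∑ q, w q = 1)
    (hΛ : Λ = ∑ q, w q • Matrix.vecMulVec (ψ q) (ψ q)) (hu : IsUnit Λ)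
    (hL : ∀ q, ψ q ⬝ᵥ Λ⁻¹ *ᵥ ψ q ≤ L) (hL0 : 0 < L) {ε : ℝ} (hε : 0 < ε) (T : ℕ) :
    ∑ q : Fin T → Q with
        ¬ ∀ v : ι → ℝ, (1 - ε) * T * (v ⬝ᵥ Λ *ᵥ v) ≤ ∑ t, (ψ (q t) ⬝ᵥ v) ^ 2,
      ∏ t, w (q t) ≤ Fintype.card ι * Real.exp (-(ε ^ 2 * T / (2 * L))) := by
  have hpsd : Λ.PosSemidef := hΛ ▸ posSemidef_sum_smul_vecMulVec hw
  obtain ⟨B, hB, hΛB⟩ := exists_isUnit_transpose_mul_self_eq hpsd hu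
  have hdet : IsUnit B.det := (Matrix.isUnit_iff_isUnit_det _).1 hB
  have hBB : B⁻¹ * B = 1 := Matrix.nonsing_inv_mul _ hdet
  have hBB' : B * B⁻¹ = 1 := Matrix.mul_nonsing_inv _ hdet
  have hBT : (B⁻¹)ᵀ * Bᵀ = 1 := by rw [← Matrix.transpose_mul, hBB', Matrix.transpose_one]
  -- Whitened features: covariance `1` and squared norm `ψ q ⬝ᵥ Λ⁻¹ *ᵥ ψ q`.
  set x : Q → ι → ℝ := fun q => (B⁻¹)ᵀ *ᵥ ψ q with hx
  have hxv : ∀ q v, x q ⬝ᵥ B *ᵥ v = ψ q ⬝ᵥ v := fun q v => by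
    simp only [hx]
    rw [Matrix.mulVec_transpose, ← Matrix.dotProduct_mulVec, Matrix.mulVec_mulVec, hBB,
      Matrix.one_mulVec]
  have hcov : ∑ q, w q • Matrix.vecMulVec (x q) (x q) = 1 := by
    have : ∀ q, w q • Matrix.vecMulVec (x q) (x q) =
        (B⁻¹)ᵀ * (w q • Matrix.vecMulVec (ψ q) (ψ q)) * B⁻¹ := fun q => by
      simp only [hx]
      rw [mul_smul_comm, smul_mul_assoc, Matrix.mul_vecMulVec, Matrix.vecMulVec_mul,
        Matrix.mulVec_transpose]
    simp only [this]
    rw [← Finset.sum_mul, ← Finset.mul_sum, ← hΛ, hΛB, ← mul_assoc, hBT, one_mul, hBB']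
  have hxL : ∀ q, x q ⬝ᵥ x q ≤ L := fun q => by
    refine le_trans (le_of_eq ?_) (hL q)
    have : Λ⁻¹ = B⁻¹ * (B⁻¹)ᵀ := by
      rw [hΛB, Matrix.mul_inv_rev, Matrix.transpose_nonsing_inv]
    rw [this, ← Matrix.mulVec_mulVec, Matrix.dotProduct_mulVec (ψ q), ← Matrix.mulVec_transpose]
  refine le_trans (Finset.sum_le_sum_of_subset_of_nonneg (fun q hq => ?_) fun q _ _ =>
    Finset.prod_nonneg fun t _ => hw _) (isotropic_matrix_chernoff hw hw1 hxL hcov hL0 hε T)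
  simp only [Finset.mem_filter, Finset.mem_univ, true_and] at hq ⊢
  refine fun h => hq fun v => ?_
  have := h (B *ᵥ v)
  simp only [hxv] at this
  rwa [hΛB, dotProduct_transpose_mul_self_mulVec]

end Covariance

/-! ### Deterministic bounds for the regularized inverse. -/

section Ridge

theorem posDef_add_smul_one {ι : Type*} [DecidableEq ι] {G : Matrix ι ι ℝ} {τ : ℝ}
    (hG : G.PosSemidef) (hτ : 0 < τ) :
    (G + τ • (1 : Matrix ι ι ℝ)).PosDef :=
  Matrix.PosDef.posSemidef_add hG (Matrix.PosDef.one.smul hτ)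

variable {ι : Type*} [Fintype ι] {Λ G : Matrix ι ι ℝ} {τ κ : ℝ}

/-- Cauchy–Schwarz, then each Euclidean norm is traded for a `Λ`-norm at the cost of `1/√μ`. -/
theorem ridge_bias_le (hΛ : Λ.PosSemidef) {μ : ℝ} (hμ : 0 < μ) (hτ : 0 ≤ τ)
    (hμΛ : ∀ v : ι → ℝ, μ * (v ⬝ᵥ v) ≤ v ⬝ᵥ Λ *ᵥ v) (z θ : ι → ℝ) :
    |τ * (z ⬝ᵥ θ)| ≤ τ / μ * (√(z ⬝ᵥ Λ *ᵥ z) * √(θ ⬝ᵥ Λ *ᵥ θ)) := by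
  have hΛz : 0 ≤ z ⬝ᵥ Λ *ᵥ z := by simpa using hΛ.dotProduct_mulVec_nonneg z
  have h1 : (z ⬝ᵥ θ) ^ 2 ≤ (z ⬝ᵥ z) * (θ ⬝ᵥ θ) := by
    have := Finset.sum_mul_sq_le_sq_mul_sq Finset.univ z θ
    simpa only [dotProduct, pow_two] using this
  have hz : 0 ≤ z ⬝ᵥ z := Finset.sum_nonneg fun i _ => mul_self_nonneg _
  have hθ : 0 ≤ θ ⬝ᵥ θ := Finset.sum_nonneg fun i _ => mul_self_nonneg _
  rw [abs_mul, abs_of_nonneg hτ, div_mul_eq_mul_div, mul_div_assoc]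
  refine mul_le_mul_of_nonneg_left ?_ hτ
  rw [le_div_iff₀ hμ, ← Real.sqrt_mul hΛz]
  refine Real.le_sqrt_of_sq_le ?_
  rw [mul_pow, sq_abs]
  have h2 : (μ * (z ⬝ᵥ z)) * (μ * (θ ⬝ᵥ θ)) ≤ (z ⬝ᵥ Λ *ᵥ z) * (θ ⬝ᵥ Λ *ᵥ θ) :=
    mul_le_mul (hμΛ z) (hμΛ θ) (by positivity) hΛz
  nlinarith [mul_le_mul_of_nonneg_right h1 (sq_nonneg μ)]

variable [DecidableEq ι]

/-- Bounds on `z = (G + τ I)⁻¹ p` when `G ≥ κ Λ`. -/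
theorem ridge_bounds (hΛ : Λ.PosSemidef) (hu : IsUnit Λ) (hτ : 0 < τ)
    (hκ : 0 < κ) (hGΛ : ∀ v : ι → ℝ, κ * (v ⬝ᵥ Λ *ᵥ v) ≤ v ⬝ᵥ G *ᵥ v) (p : ι → ℝ) {z : ι → ℝ}
    (hz : (G + τ • (1 : Matrix ι ι ℝ)) *ᵥ z = p) :
    z ⬝ᵥ G *ᵥ z ≤ (p ⬝ᵥ Λ⁻¹ *ᵥ p) / κ ∧ √(z ⬝ᵥ Λ *ᵥ z) ≤ √(p ⬝ᵥ Λ⁻¹ *ᵥ p) / κ := by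
  have hp : z ⬝ᵥ G *ᵥ z + τ * (z ⬝ᵥ z) = p ⬝ᵥ z := by
    rw [← hz, dotProduct_comm ((G + _) *ᵥ z) z, Matrix.add_mulVec, dotProduct_add, Matrix.smul_mulVec,
      Matrix.one_mulVec, dotProduct_smul, smul_eq_mul]
  have hzz : 0 ≤ z ⬝ᵥ z := Finset.sum_nonneg fun i _ => mul_self_nonneg _
  have hle : z ⬝ᵥ G *ᵥ z ≤ p ⬝ᵥ z := by nlinarith
  have hΛz : 0 ≤ z ⬝ᵥ Λ *ᵥ z := by simpa using hΛ.dotProduct_mulVec_nonneg z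
  have hΛp : 0 ≤ p ⬝ᵥ Λ⁻¹ *ᵥ p := by simpa using hΛ.inv.dotProduct_mulVec_nonneg p
  have hcs := dotProduct_sq_le_inv hΛ hu p z
  have hcs' : p ⬝ᵥ z ≤ √(p ⬝ᵥ Λ⁻¹ *ᵥ p) * √(z ⬝ᵥ Λ *ᵥ z) := by
    rw [← Real.sqrt_mul hΛp]
    exact Real.le_sqrt_of_sq_le hcs
  set a := √(p ⬝ᵥ Λ⁻¹ *ᵥ p) with ha
  set b := √(z ⬝ᵥ Λ *ᵥ z) with hb
  have hb2 : b ^ 2 = z ⬝ᵥ Λ *ᵥ z := Real.sq_sqrt hΛz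
  have ha2 : a ^ 2 = p ⬝ᵥ Λ⁻¹ *ᵥ p := Real.sq_sqrt hΛp
  have ha0 : 0 ≤ a := Real.sqrt_nonneg _
  have hb0 : 0 ≤ b := Real.sqrt_nonneg _
  -- Cancel `b` in `κ b² ≤ zᵀGz ≤ p ⬝ᵥ z ≤ a b`.
  have hkb : κ * b ≤ a := by
    rcases hb0.eq_or_lt with h | h
    · rw [← h, mul_zero]; exact ha0
    · have h1 := hGΛ z
      rw [← hb2] at h1
      exact le_of_mul_le_mul_right (by nlinarith) h
  refine ⟨?_, by rwa [le_div_iff₀ hκ, mul_comm]⟩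
  rw [le_div_iff₀ hκ, ← ha2]
  nlinarith [mul_le_mul_of_nonneg_left hkb ha0, mul_le_mul_of_nonneg_left (hle.trans hcs') hκ.le]

end Ridge

theorem lambdaMin_mul_dotProduct_le {d : ℕ} {Λ : Matrix (Fin d) (Fin d) ℝ} (hΛ : Λ.IsSymm)
    (v : Fin d → ℝ) : lambdaMin Λ * (v ⬝ᵥ v) ≤ v ⬝ᵥ Λ *ᵥ v :=
  mul_dotProduct_le_of_forall_spectrum_ge hΛ
    (fun _ ha => csInf_le (Matrix.finite_real_spectrum (A := Λ)).bddBelow ha) v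

/-! ### Bandit quantities and the exact error decomposition. -/

section Estimator

variable {m n d T : ℕ} {ρ : Fin m → ℝ} {πb : Fin m → Fin n → ℝ} {π : Fin m → Fin n → ℝ}
  {ψ : Fin m → Fin n → Fin d → ℝ} {θ : Fin d → ℝ}

theorem weight_nonneg (hρ : ρ ∈ stdSimplex ℝ (Fin m)) (hπ : ∀ a, π a ∈ stdSimplex ℝ (Fin n))
    (a : Fin m) (b : Fin n) : 0 ≤ weight ρ π a b :=
  mul_nonneg (hρ.1 a) ((hπ a).1 b)

theorem sum_weight (hρ : ρ ∈ stdSimplex ℝ (Fin m)) (hπ : ∀ a, π a ∈ stdSimplex ℝ (Fin n)) :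
    ∑ q : Fin m × Fin n, weight ρ π q.1 q.2 = 1 := by
  rw [Fintype.sum_prod_type]
  simp only [weight, ← Finset.mul_sum, (hπ _).2, mul_one]
  exact hρ.2

theorem covMatrix_eq_sum : covMatrix ρ πb ψ =
    ∑ q : Fin m × Fin n, weight ρ πb q.1 q.2 • Matrix.vecMulVec (ψ q.1 q.2) (ψ q.1 q.2) := by
  rw [Fintype.sum_prod_type]; rfl

theorem le_Lfeat (a : Fin m) (b : Fin n) :
    ψ a b ⬝ᵥ (covMatrix ρ πb ψ)⁻¹ *ᵥ ψ a b ≤ Lfeat ρ πb ψ :=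
  le_ciSup (f := fun q : Fin m × Fin n => ψ q.1 q.2 ⬝ᵥ (covMatrix ρ πb ψ)⁻¹ *ᵥ ψ q.1 q.2)
    (Set.finite_range _).bddAbove (a, b)

theorem le_Lparam (a : Fin m) (b : Fin n) : |ψ a b ⬝ᵥ θ| ≤ Lparam ψ θ :=
  le_ciSup (f := fun q : Fin m × Fin n => |ψ q.1 q.2 ⬝ᵥ θ|) (Set.finite_range _).bddAbove (a, b)

theorem Lparam_nonneg : 0 ≤ Lparam ψ θ := Real.iSup_nonneg fun _ => abs_nonneg _

theorem sqrt_dotProduct_covMatrix_le (hρ : ρ ∈ stdSimplex ℝ (Fin m))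
    (hπ : ∀ a, πb a ∈ stdSimplex ℝ (Fin n)) :
    √(θ ⬝ᵥ covMatrix ρ πb ψ *ᵥ θ) ≤ Lparam ψ θ := by
  refine Real.sqrt_le_iff.2 ⟨Lparam_nonneg, ?_⟩
  rw [covMatrix_eq_sum, Matrix.sum_mulVec, dotProduct_sum, ← one_mul (Lparam ψ θ ^ 2),
    ← sum_weight hρ hπ, Finset.sum_mul]
  refine Finset.sum_le_sum fun q _ => ?_
  rw [Matrix.smul_mulVec, dotProduct_smul, dotProduct_vecMulVec_mulVec, smul_eq_mul, ← sq_abs]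
  exact mul_le_mul_of_nonneg_left (pow_le_pow_left₀ (abs_nonneg _) (le_Lparam _ _) 2)
    (weight_nonneg hρ hπ _ _)

theorem policyValue_eq : policyValue ρ π ψ θ = meanFeature ρ π ψ ⬝ᵥ θ := by
  simp only [policyValue, meanFeature, sum_dotProduct, smul_dotProduct, smul_eq_mul]

theorem policyValue_sub_valueHat_eq {τ : ℝ} (hτ : 0 < τ) (i : Fin T → Fin m) (j : Fin T → Fin n)
    (r ξ : Fin T → ℝ) (hr : ∀ t, r t = ψ (i t) (j t) ⬝ᵥ θ + ξ t) {z : Fin d → ℝ}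
    (hz : ((∑ t, Matrix.vecMulVec (ψ (i t) (j t)) (ψ (i t) (j t))) +
      τ • (1 : Matrix (Fin d) (Fin d) ℝ)) *ᵥ z = meanFeature ρ π ψ) :
    policyValue ρ π ψ θ - valueHat ρ π ψ τ i j r =
      τ * (z ⬝ᵥ θ) - ∑ t, (ψ (i t) (j t) ⬝ᵥ z) * ξ t := by
  set M := (∑ t, Matrix.vecMulVec (ψ (i t) (j t)) (ψ (i t) (j t))) +
      τ • (1 : Matrix (Fin d) (Fin d) ℝ) with hM
  have hG : (∑ t, Matrix.vecMulVec (ψ (i t) (j t)) (ψ (i t) (j t))).PosSemidef := by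
    have := posSemidef_sum_smul_vecMulVec (w := fun _ : Fin T => (1 : ℝ))
      (ψ := fun t => ψ (i t) (j t)) fun _ => zero_le_one
    simpa using this
  have hpd := posDef_add_smul_one hG hτ
  rw [← hM] at hpd
  have hs : M.IsSymm := by
    have := hpd.1
    rwa [Matrix.IsHermitian, Matrix.conjTranspose_eq_transpose_of_trivial] at this
  have hdet : IsUnit M.det := (Matrix.isUnit_iff_isUnit_det _).1 hpd.isUnit
  have h1 : valueHat ρ π ψ τ i j r = z ⬝ᵥ ∑ t, r t • ψ (i t) (j t) := by
    rw [valueHat, thetaHat, ← hM, ← hz, dotProduct_mulVec_comm hs, Matrix.mulVec_mulVec,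
      Matrix.mul_nonsing_inv _ hdet, Matrix.one_mulVec, dotProduct_comm]
  have h2 : meanFeature ρ π ψ ⬝ᵥ θ =
      ∑ t, (ψ (i t) (j t) ⬝ᵥ z) * (ψ (i t) (j t) ⬝ᵥ θ) + τ * (z ⬝ᵥ θ) := by
    rw [← hz, hM, Matrix.add_mulVec, add_dotProduct, Matrix.smul_mulVec, Matrix.one_mulVec,
      smul_dotProduct, smul_eq_mul, Matrix.sum_mulVec, sum_dotProduct]
    congr 1
    refine Finset.sum_congr rfl fun t _ => ?_
    rw [Matrix.vecMulVec_mulVec]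
    simp [smul_dotProduct, mul_comm]
  rw [policyValue_eq, h1, h2, dotProduct_sum]
  simp only [hr, dotProduct_smul, smul_eq_mul, add_mul, Finset.sum_add_distrib,
    dotProduct_comm z (ψ _ _)]
  have e1 : ∀ t, (ψ (i t) (j t) ⬝ᵥ θ) * (ψ (i t) (j t) ⬝ᵥ z) =
    (ψ (i t) (j t) ⬝ᵥ z) * (ψ (i t) (j t) ⬝ᵥ θ) := fun t => mul_comm _ _
  have e2 : ∀ t, ξ t * (ψ (i t) (j t) ⬝ᵥ z) = (ψ (i t) (j t) ⬝ᵥ z) * ξ t := fun t => mul_comm _ _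
  simp only [e1, e2]
  ring

end Estimator

/-! ### Subgaussian tails and conditioning on the design. -/

section Probability

variable {Ω : Type*} [MeasurableSpace Ω] {P : Measure Ω}

theorem measureReal_pairs_eq {m n T : ℕ} {w : Fin m × Fin n → ℝ} {i : Fin T → Ω → Fin m}
    {j : Fin T → Ω → Fin n}
    (hlaw : ∀ t a b, P.real {ω | i t ω = a ∧ j t ω = b} = w (a, b))
    (hind : iIndepFun (fun t ω => (i t ω, j t ω)) P) (q : Fin T → Fin m × Fin n) :
    P.real ((fun ω t => (i t ω, j t ω)) ⁻¹' {q}) = ∏ t, w (q t) := by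
  have e : (fun ω t => (i t ω, j t ω)) ⁻¹' {q} =
      ⋂ t ∈ (Finset.univ : Finset (Fin T)), (fun ω => (i t ω, j t ω)) ⁻¹' {q t} := by
    ext ω; simp [funext_iff]
  rw [e, measureReal_def, hind.measure_inter_preimage_eq_mul Finset.univ
    (sets := fun t => {q t}) fun t _ => measurableSet_singleton _, ENNReal.toReal_prod]
  refine Finset.prod_congr rfl fun t _ => ?_
  rw [← Prod.mk.eta (p := q t), ← hlaw t, measureReal_def]
  congr 2
  ext ω; simp [Prod.ext_iff]

variable [IsProbabilityMeasure P]

theorem measureReal_sqrt_lt_abs_le {X : Ω → ℝ} {c : ℝ≥0} (h : HasSubgaussianMGF X c P) {b : ℝ}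
    (hb : 0 ≤ b) : P.real {ω | √(2 * c * b) < |X ω|} ≤ 2 * Real.exp (-b) := by
  -- For `c = 0` the variable vanishes almost surely; the strict inequality makes the event null.
  rcases eq_or_ne c 0 with rfl | hc
  · have h0 := HasSubgaussianMGF.ae_eq_zero_of_hasSubgaussianMGF_zero h
    have : P {ω | √(2 * ((0 : ℝ≥0) : ℝ) * b) < |X ω|} = 0 := by
      refine measure_mono_null (fun ω hω => ?_) h0
      intro h
      simp only [Set.mem_ofPred_eq] at hω h
      rw [h] at hω
      simp at hω
    rw [measureReal_def, this]
    simp only [ENNReal.toReal_zero]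
    positivity
  · have hc0 : (0 : ℝ) < c := by exact_mod_cast pos_iff_ne_zero.2 hc
    have he : -√(2 * c * b) ^ 2 / (2 * c) = -b := by
      rw [Real.sq_sqrt (by positivity)]; field_simp
    have h1 := h.measure_ge_le (Real.sqrt_nonneg (2 * c * b))
    have h2 := h.neg.measure_ge_le (Real.sqrt_nonneg (2 * c * b))
    rw [he] at h1 h2
    have hsub : {ω | √(2 * c * b) < |X ω|} ⊆
        {ω | √(2 * c * b) ≤ X ω} ∪ {ω | √(2 * c * b) ≤ (-X) ω} := fun ω hω => by
      rw [Set.mem_ofPred_eq] at hω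
      rcases lt_abs.1 hω with h | h
      · exact Or.inl h.le
      · exact Or.inr h.le
    calc _ ≤ _ := measureReal_mono hsub
      _ ≤ _ := measureReal_union_le _ _
      _ ≤ _ := by linarith

theorem measureReal_linearCombination_le {T : ℕ} {ξ : Fin T → Ω → ℝ} {σ : ℝ≥0}
    (hi : iIndepFun ξ P) (hs : ∀ t, HasSubgaussianMGF (ξ t) (σ ^ 2) P) (c : Fin T → ℝ) {b s : ℝ}
    (hb : 0 ≤ b) (hc : ∑ t, c t ^ 2 ≤ s) :
    P.real {ω | σ * √(2 * b * s) < |∑ t, c t * ξ t ω|} ≤ 2 * Real.exp (-b) := by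
  have h1 : iIndepFun (fun t ω => c t * ξ t ω) P :=
    hi.comp (fun t y => c t * y) fun t => measurable_const_mul _
  have h0 : ∀ t, HasSubgaussianMGF (fun ω => c t * ξ t ω) (‖c t‖₊ ^ 2 * σ ^ 2) P := fun t => by
    have he : (‖c t‖₊ ^ 2 : ℝ≥0) = ⟨c t ^ 2, sq_nonneg _⟩ := NNReal.eq (by simp; rfl)
    rw [he]
    exact (hs t).const_mul (c t)
  have h2 := HasSubgaussianMGF.sum_of_iIndepFun h1 (s := Finset.univ)
    fun t _ => h0 t
  refine le_trans (measureReal_mono fun ω hω => ?_) (measureReal_sqrt_lt_abs_le h2 hb)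
  rw [Set.mem_ofPred_eq] at hω ⊢
  refine lt_of_le_of_lt ?_ hω
  have hs0 : (0 : ℝ) ≤ σ := σ.2
  rw [← Real.sqrt_sq hs0, ← Real.sqrt_mul (sq_nonneg _)]
  refine Real.sqrt_le_sqrt ?_
  push_cast
  simp only [Real.norm_eq_abs, sq_abs, ← Finset.sum_mul]
  have : 2 * (σ : ℝ) ^ 2 * b * ∑ t, c t ^ 2 ≤ 2 * (σ : ℝ) ^ 2 * b * s :=
    mul_le_mul_of_nonneg_left hc (by positivity)
  linarith

-- Conditioning on `X` as a finite sum: on each `{X = q}` independence factors out the probability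
-- of `B q`, so the exceptional set for `Y` may depend on `X`.
open Classical in
theorem measureReal_notMem_or_mem_le {α β : Type*} [Fintype α] [MeasurableSpace α]
    [MeasurableSingletonClass α] [MeasurableSpace β] {X : Ω → α} {Y : Ω → β} (hX : Measurable X)
    (hYX : IndepFun Y X P) (good : α → Prop) (B : α → Set β) (hB : ∀ q, MeasurableSet (B q))
    {η₁ η₂ : ℝ} (hη₁ : 0 ≤ η₁) (h₁ : ∀ q, good q → P.real (Y ⁻¹' B q) ≤ η₁)
    (h₂ : ∑ q with ¬ good q, P.real (X ⁻¹' {q}) ≤ η₂) :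
    P.real {ω | ¬ good (X ω) ∨ Y ω ∈ B (X ω)} ≤ η₁ + η₂ := by
  have hsub : {ω | ¬ good (X ω) ∨ Y ω ∈ B (X ω)} ⊆
      (⋃ q ∈ (Finset.univ : Finset α).filter fun q => good q, (Y ⁻¹' B q ∩ X ⁻¹' {q})) ∪
        ⋃ q ∈ (Finset.univ : Finset α).filter fun q => ¬ good q, X ⁻¹' {q} := by
    intro ω hω
    by_cases hg : good (X ω)
    · left
      simp only [Set.mem_iUnion]
      exact ⟨X ω, by simpa using hg, hω.resolve_left (not_not.2 hg), rfl⟩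
    · right
      simp only [Set.mem_iUnion]
      exact ⟨X ω, by simpa using hg, rfl⟩
  have hind : ∀ q, P.real (Y ⁻¹' B q ∩ X ⁻¹' {q}) = P.real (Y ⁻¹' B q) * P.real (X ⁻¹' {q}) :=
    fun q => by
      simp only [measureReal_def]
      rw [hYX.measure_inter_preimage_eq_mul _ _ (hB q) (measurableSet_singleton q),
        ENNReal.toReal_mul]
  have htot : ∑ q, P.real (X ⁻¹' {q}) = 1 := by
    have := sum_measureReal_preimage_singleton (μ := P) (f := X) Finset.univ
      fun q _ => hX (measurableSet_singleton q)
    simpa using this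
  calc _ ≤ _ := measureReal_mono hsub
    _ ≤ _ := measureReal_union_le _ _
    _ ≤ η₁ + η₂ := by
      refine add_le_add ((measureReal_biUnion_finset_le _ _).trans ?_)
        ((measureReal_biUnion_finset_le _ _).trans h₂)
      calc _ ≤ ∑ q with good q, η₁ * P.real (X ⁻¹' {q}) := by
            refine Finset.sum_le_sum fun q hq => ?_
            rw [hind]
            exact mul_le_mul_of_nonneg_right (h₁ q (Finset.mem_filter.1 hq).2) measureReal_nonneg
        _ ≤ ∑ q, η₁ * P.real (X ⁻¹' {q}) :=
            Finset.sum_le_sum_of_subset_of_nonneg (Finset.filter_subset _ _) fun q _ _ =>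
              mul_nonneg hη₁ measureReal_nonneg
        _ = η₁ := by rw [← Finset.mul_sum, htot, mul_one]

end Probability

/-! ### Assembling the error bound. -/

theorem one_div_sqrt_one_sub_le {ε : ℝ} (h0 : 0 ≤ ε) (h1 : ε ≤ 1 / 3) :
    1 / (1 - ε) ≤ 1 + 3 / 2 * ε ∧ 1 / √(1 - ε) ≤ 1 + 3 / 2 * ε := by
  have hp : 0 < 1 - ε := by linarith
  have hA : 1 / (1 - ε) ≤ 1 + 3 / 2 * ε := by
    -- `(1 - ε)(1 + 3ε/2) = 1 + ε(1 - 3ε)/2`, which is at least `1` exactly because `ε ≤ 1/3`.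
    rw [div_le_iff₀ hp]; nlinarith
  refine ⟨hA, le_trans ?_ hA⟩
  refine one_div_le_one_div_of_le hp ?_
  exact Real.le_sqrt_of_sq_le (by nlinarith)

theorem rpow_three_halves {x : ℝ} (hx : 0 ≤ x) : x ^ (3 / 2 : ℝ) = x * √x := by
  rw [show (3 / 2 : ℝ) = 1 + 1 / 2 by norm_num, Real.rpow_add' hx (by norm_num), Real.rpow_one,
    Real.sqrt_eq_rpow]

/-- The bias and noise bounds obtained on the event `G ≥ (1 - ε) T Λ`, with
`ε = √(2 L a / T)`, are dominated by the error expansion in powers of `1 / √T`. -/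
theorem bias_add_noise_le {d : ℕ} (hd : 0 < d) {T N L K σ δ a ε : ℝ} (hT : 0 < T) (hN : 0 ≤ N)
    (hL : 0 < L) (hK : 0 ≤ K) (hσ : 0 ≤ σ) (hδ : 0 < δ) (hδ1 : δ < 1)
    (ha0 : 0 < a) (ha : a ≤ Real.log (16 * (d + 1) / δ)) (hTa : 18 * L * a ≤ T)
    (hε : ε = √(2 * L * a / T)) :
    L * a * (N / ((1 - ε) * T) * K) + σ * √(2 * Real.log (8 / δ) * (N ^ 2 / ((1 - ε) * T))) ≤
      1 / √T * E1 N σ δ + 1 / T * E2 d N L K σ δ + 1 / T ^ (3 / 2 : ℝ) * E3 d N L K σ δ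
        + 1 / T ^ 2 * E4 d N L σ δ := by
  have hd1 : (1 : ℝ) ≤ d := by exact_mod_cast hd
  set b := Real.log (8 / δ) with hb
  set l := Real.log (16 * (d + 1) / δ) with hl
  have hb0 : 0 ≤ b := Real.log_nonneg (by rw [le_div_iff₀ hδ]; linarith)
  have hbl : b ≤ l := Real.log_le_log (by positivity) (by gcongr; nlinarith)
  have hl0 : 0 < l := ha0.trans_le ha
  have hε0 : 0 ≤ ε := hε ▸ Real.sqrt_nonneg _
  have hε1 : ε ≤ 1 / 3 := by
    rw [hε, Real.sqrt_le_iff]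
    refine ⟨by norm_num, ?_⟩
    rw [div_le_iff₀ hT]; linarith
  have hp : 0 < 1 - ε := by linarith
  obtain ⟨h1, h2⟩ := one_div_sqrt_one_sub_le hε0 hε1
  have hsT : 0 < √T := Real.sqrt_pos.2 hT
  have hsT2 : √T * √T = T := Real.mul_self_sqrt hT.le
  have hεl : ε ≤ √2 * (√L * √l) / √T := by
    rw [hε, ← Real.sqrt_mul hL.le, ← Real.sqrt_mul zero_le_two, ← Real.sqrt_div (by positivity)]
    refine Real.sqrt_le_sqrt ?_
    rw [← mul_assoc]
    gcongr
  have hs2 : √2 ≤ 3 / 2 := by rw [Real.sqrt_le_iff]; norm_num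
  have hs22 : √2 * √2 = 2 := Real.mul_self_sqrt zero_le_two
  have hsl : √l * √l = l := Real.mul_self_sqrt hl0.le
  -- The expansion has slack: `E4` enters only through its sign, and only parts of `E3` and `E2` are
  -- used.
  have hE4 : 0 ≤ 1 / T ^ 2 * E4 d N L σ δ := by
    rw [E4, ← hl]; positivity
  have hE3 : N * (4 * √L * K) * L * (l * √l) / (T * √T) ≤
      1 / T ^ (3 / 2 : ℝ) * E3 d N L K σ δ := by
    rw [E3, ← hl, rpow_three_halves hl0.le, rpow_three_halves hT.le, one_div_mul_eq_div]
    gcongr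
    have : 0 ≤ σ * √2 / 3 + 4 * σ * √d := by positivity
    linarith
  have hE2 : N * (L * K + σ * 3 * √L) * l / T ≤ 1 / T * E2 d N L K σ δ := by
    rw [E2, ← hl, one_div_mul_eq_div]
    have : 1 ≤ √(2 * d) := Real.one_le_sqrt.2 (by linarith)
    gcongr
    linarith
  have hbias : L * a * (N / ((1 - ε) * T) * K) ≤
      N * (L * K) * l / T + N * (4 * √L * K) * L * (l * √l) / (T * √T) := by
    calc L * a * (N / ((1 - ε) * T) * K) = L * a * N * K / T * (1 / (1 - ε)) := by
          field_simp
      _ ≤ L * l * N * K / T * (1 + 3 / 2 * (√2 * (√L * √l) / √T)) := by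
          gcongr
          exact h1.trans (by linarith)
      _ = N * (L * K) * l / T + N * (3 / 2 * √2 * √L * K) * L * (l * √l) / (T * √T) := by
          field_simp
      _ ≤ _ := by
          gcongr
          linarith
  have hnoise : σ * √(2 * b * (N ^ 2 / ((1 - ε) * T))) ≤
      1 / √T * E1 N σ δ + N * (σ * 3 * √L) * l / T := by
    have e1 : √(2 * b * (N ^ 2 / ((1 - ε) * T))) = N * (√2 * √b) / √T * (1 / √(1 - ε)) := by
      rw [Real.sqrt_mul (by positivity), Real.sqrt_div (sq_nonneg N), Real.sqrt_sq hN,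
        Real.sqrt_mul hp.le, Real.sqrt_mul zero_le_two]
      have : 0 < √(1 - ε) := Real.sqrt_pos.2 hp
      field_simp
    have e2 : E1 N σ δ = N * (σ * (√2 * √b)) := by
      rw [E1, ← hb, mul_assoc, mul_left_comm, Real.sqrt_mul (sq_nonneg σ), Real.sqrt_sq hσ,
        Real.sqrt_mul zero_le_two]
    rw [e1, e2]
    have hbl' : √b ≤ √l := Real.sqrt_le_sqrt hbl
    calc σ * (N * (√2 * √b) / √T * (1 / √(1 - ε)))
        ≤ σ * (N * (√2 * √b) / √T * (1 + 3 / 2 * (√2 * (√L * √l) / √T))) := by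
          gcongr
          exact h2.trans (by linarith)
      _ = 1 / √T * (N * (σ * (√2 * √b))) +
          N * (σ * (3 / 2 * (√2 * √2)) * √L) * (√b * √l) / (√T * √T) := by
          field_simp
      _ ≤ 1 / √T * (N * (σ * (√2 * √b))) +
          N * (σ * (3 / 2 * (√2 * √2)) * √L) * (√l * √l) / (√T * √T) := by
          gcongr
      _ = _ := by rw [hs22, hsl, hsT2]; ring
  have hsplit : N * (L * K + σ * 3 * √L) * l / T =
      N * (L * K) * l / T + N * (σ * 3 * √L) * l / T := by ring
  linarith

/-- Non-asymptotic error bound for the plug-in estimator. -/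
theorem one_sub_le_measureReal_error_le {m n d : ℕ} (hd : 0 < d)
    {ρ : Fin m → ℝ} (hρ : ρ ∈ stdSimplex ℝ (Fin m))
    {πb : Fin m → Fin n → ℝ} (hπb : ∀ a, πb a ∈ stdSimplex ℝ (Fin n))
    {π : Fin m → Fin n → ℝ} {ψ : Fin m → Fin n → Fin d → ℝ} (hΛ : IsUnit (covMatrix ρ πb ψ))
    {θ : Fin d → ℝ} {σ : ℝ≥0} {δ : ℝ} (hδ : 0 < δ) (hδ1 : δ < 1)
    {T : ℕ} {τ : ℝ} {Ω : Type*} [MeasurableSpace Ω] {P : Measure Ω} [IsProbabilityMeasure P]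
    {i : Fin T → Ω → Fin m} {j : Fin T → Ω → Fin n} {r ξ : Fin T → Ω → ℝ}
    (hs : IsSample ρ πb ψ θ σ P i j r ξ) (hL : 0 < Lfeat ρ πb ψ)
    (hT : 18 * Lfeat ρ πb ψ * Real.log (8 * d / δ) ≤ T) (hτ : 0 < τ)
    (hτ' : τ ≤ Lfeat ρ πb ψ * Real.log (8 * d / δ) * lambdaMin (covMatrix ρ πb ψ)) :
    1 - δ ≤ P.real {ω |
      |policyValue ρ π ψ θ
          - valueHat ρ π ψ τ (fun t => i t ω) (fun t => j t ω) (fun t => r t ω)|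
        ≤ 1 / √(T : ℝ) * E1 (wnorm (covMatrix ρ πb ψ)⁻¹ (meanFeature ρ π ψ)) σ δ
          + 1 / (T : ℝ) * E2 d (wnorm (covMatrix ρ πb ψ)⁻¹ (meanFeature ρ π ψ))
              (Lfeat ρ πb ψ) (Lparam ψ θ) σ δ
          + 1 / (T : ℝ) ^ (3 / 2 : ℝ) * E3 d (wnorm (covMatrix ρ πb ψ)⁻¹ (meanFeature ρ π ψ))
              (Lfeat ρ πb ψ) (Lparam ψ θ) σ δ
          + 1 / (T : ℝ) ^ 2 * E4 d (wnorm (covMatrix ρ πb ψ)⁻¹ (meanFeature ρ π ψ))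
              (Lfeat ρ πb ψ) σ δ} := by
  classical
  set Λ := covMatrix ρ πb ψ with hΛdef
  set L := Lfeat ρ πb ψ with hLdef
  set K := Lparam ψ θ with hKdef
  set p := meanFeature ρ π ψ with hp
  set N := wnorm Λ⁻¹ p with hN
  set a := Real.log (8 * d / δ) with ha
  set b := Real.log (8 / δ) with hb
  set w : Fin m × Fin n → ℝ := fun q => weight ρ πb q.1 q.2 with hw
  have hd1 : (1 : ℝ) ≤ d := by exact_mod_cast hd
  have ha0 : 0 < a := Real.log_pos (by rw [lt_div_iff₀ hδ]; linarith)
  have hb0 : 0 ≤ b := Real.log_nonneg (by rw [le_div_iff₀ hδ]; linarith)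
  have hal : a ≤ Real.log (16 * (d + 1) / δ) :=
    Real.log_le_log (by positivity) (by gcongr <;> linarith)
  have hT0 : (0 : ℝ) < T := lt_of_lt_of_le (by positivity) hT
  have hw0 : ∀ q, 0 ≤ w q := fun q => weight_nonneg hρ hπb _ _
  have hw1 : ∑ q, w q = 1 := sum_weight hρ hπb
  have hΛsum : Λ = ∑ q, w q • Matrix.vecMulVec (ψ q.1 q.2) (ψ q.1 q.2) := covMatrix_eq_sum
  have hpsd : Λ.PosSemidef := hΛsum ▸ posSemidef_sum_smul_vecMulVec hw0
  have hsymm : Λ.IsSymm := by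
    have := hpsd.1
    rwa [Matrix.IsHermitian, Matrix.conjTranspose_eq_transpose_of_trivial] at this
  -- Positivity is read off from the range allowed for `τ`.
  have hμ : 0 < lambdaMin Λ := pos_of_mul_pos_right (hτ.trans_le hτ') (by positivity)
  have hΛp : 0 ≤ p ⬝ᵥ Λ⁻¹ *ᵥ p := by simpa using hpsd.inv.dotProduct_mulVec_nonneg p
  have hN0 : 0 ≤ N := Real.sqrt_nonneg _
  have hN2 : N ^ 2 = p ⬝ᵥ Λ⁻¹ *ᵥ p := Real.sq_sqrt hΛp
  set ε := √(2 * L * a / T) with hε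
  have hε0 : 0 < ε := Real.sqrt_pos.2 (by positivity)
  have hε1 : ε ≤ 1 / 3 := by
    rw [hε, Real.sqrt_le_iff]
    refine ⟨by norm_num, ?_⟩
    rw [div_le_iff₀ hT0]; linarith
  set κ := (1 - ε) * T with hκdef
  have hκ : 0 < κ := mul_pos (by linarith) hT0
  set G : (Fin T → Fin m × Fin n) → Matrix (Fin d) (Fin d) ℝ := fun q =>
    ∑ t, Matrix.vecMulVec (ψ (q t).1 (q t).2) (ψ (q t).1 (q t).2) with hG
  have hGpsd : ∀ q, (G q).PosSemidef := fun q => by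
    have := posSemidef_sum_smul_vecMulVec (w := fun _ : Fin T => (1 : ℝ))
      (ψ := fun t => ψ (q t).1 (q t).2) fun _ => zero_le_one
    simpa using this
  have hGv : ∀ q v, v ⬝ᵥ G q *ᵥ v = ∑ t, (ψ (q t).1 (q t).2 ⬝ᵥ v) ^ 2 := fun q v => by
    simp only [hG]
    rw [Matrix.sum_mulVec, dotProduct_sum]
    exact Finset.sum_congr rfl fun t _ => dotProduct_vecMulVec_mulVec _ _
  set z : (Fin T → Fin m × Fin n) → Fin d → ℝ := fun q =>
    (G q + τ • (1 : Matrix (Fin d) (Fin d) ℝ))⁻¹ *ᵥ p with hz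
  have hzp : ∀ q, (G q + τ • (1 : Matrix (Fin d) (Fin d) ℝ)) *ᵥ z q = p := fun q => by
    have hdet := (Matrix.isUnit_iff_isUnit_det _).1 (posDef_add_smul_one (hGpsd q) hτ).isUnit
    simp only [hz]
    rw [Matrix.mulVec_mulVec, Matrix.mul_nonsing_inv _ hdet, Matrix.one_mulVec]
  set good : (Fin T → Fin m × Fin n) → Prop := fun q =>
    ∀ v : Fin d → ℝ, (1 - ε) * T * (v ⬝ᵥ Λ *ᵥ v) ≤ ∑ t, (ψ (q t).1 (q t).2 ⬝ᵥ v) ^ 2 with hgood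
  have hridge : ∀ q, good q → ∑ t, (ψ (q t).1 (q t).2 ⬝ᵥ z q) ^ 2 ≤ N ^ 2 / κ ∧
      √(z q ⬝ᵥ Λ *ᵥ z q) ≤ N / κ := fun q hq => by
    have := ridge_bounds hpsd hΛ hτ hκ (fun v => (hq v).trans_eq (hGv q v).symm) p (hzp q)
    rwa [hGv, ← hN2, Real.sqrt_sq hN0] at this
  set B : (Fin T → Fin m × Fin n) → Set (Fin T → ℝ) := fun q =>
    {y | σ * √(2 * b * (N ^ 2 / κ)) < |∑ t, (ψ (q t).1 (q t).2 ⬝ᵥ z q) * y t|} with hB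
  have hBm : ∀ q, MeasurableSet (B q) := fun q =>
    measurableSet_lt measurable_const (by fun_prop)
  -- Failure budget: `2 exp (-b) = δ/4` for the noise, `d exp (-a) = δ/8` for the design, in total
  -- below `δ`.
  have hbad := measureReal_notMem_or_mem_le (P := P) (X := fun ω t => (i t ω, j t ω))
    (Y := fun ω t => ξ t ω) (η₁ := δ / 4) (η₂ := δ / 8)
    (measurable_pi_lambda _ fun t => (hs.measurable_context t).prodMk (hs.measurable_arm t))
    hs.noise_indep_pairs good B hBm (by positivity) (fun q hq => ?_) ?_
  -- Covering the whole space by two events and using subadditivity avoids any measurability of the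
  -- error event.
  · have hcompl : Set.univ ⊆ {ω | |policyValue ρ π ψ θ
          - valueHat ρ π ψ τ (fun t => i t ω) (fun t => j t ω) (fun t => r t ω)|
          ≤ 1 / √(T : ℝ) * E1 N σ δ + 1 / (T : ℝ) * E2 d N L K σ δ
          + 1 / (T : ℝ) ^ (3 / 2 : ℝ) * E3 d N L K σ δ + 1 / (T : ℝ) ^ 2 * E4 d N L σ δ} ∪
        {ω | ¬ good (fun t => (i t ω, j t ω)) ∨
          (fun t => ξ t ω) ∈ B (fun t => (i t ω, j t ω))} := by
      intro ω _
      by_cases hω : ¬ good (fun t => (i t ω, j t ω)) ∨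
          (fun t => ξ t ω) ∈ B (fun t => (i t ω, j t ω))
      · exact Or.inr hω
      left
      push Not at hω
      obtain ⟨hg, hn⟩ := hω
      simp only [hB, Set.mem_ofPred_eq, not_lt] at hn
      set q : Fin T → Fin m × Fin n := fun t => (i t ω, j t ω) with hq
      rw [Set.mem_ofPred_eq, policyValue_sub_valueHat_eq hτ _ _ _ (fun t => ξ t ω)
        (fun t => hs.reward_eq t ω) (hzp q)]
      refine le_trans ?_ (bias_add_noise_le hd hT0 hN0 hL Lparam_nonneg σ.2 hδ hδ1 ha0 hal hT hε)
      refine (abs_sub _ _).trans (add_le_add ?_ hn)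
      refine (ridge_bias_le hpsd hμ hτ.le (lambdaMin_mul_dotProduct_le hsymm) (z q) θ).trans ?_
      refine mul_le_mul ((div_le_iff₀ hμ).2 hτ') ?_ (by positivity) (by positivity)
      exact mul_le_mul (hridge q hg).2 (sqrt_dotProduct_covMatrix_le hρ hπb)
        (Real.sqrt_nonneg _) (by positivity)
    have h1 := (measureReal_mono (μ := P) hcompl).trans (measureReal_union_le _ _)
    rw [probReal_univ] at h1
    linarith
  · have h1 := measureReal_linearCombination_le hs.indep_noise hs.subgaussian_noise
      (fun t => ψ (q t).1 (q t).2 ⬝ᵥ z q) hb0 (hridge q hq).1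
    refine le_trans h1 (le_of_eq ?_)
    rw [hb, Real.exp_neg, Real.exp_log (by positivity)]
    field_simp
    norm_num
  · simp only [measureReal_pairs_eq (w := w) hs.law_pair hs.indep_pairs]
    refine (covariance_matrix_chernoff hw0 hw1 hΛsum hΛ (fun q => le_Lfeat _ _) hL hε0 T).trans
      (le_of_eq ?_)
    have : ε ^ 2 * T / (2 * L) = a := by
      rw [hε, Real.sq_sqrt (by positivity)]; field_simp
    rw [this, ha, Real.exp_neg, Real.exp_log (by positivity), Fintype.card_fin]
    field_simp

theorem Lfeat_pos {m n d : ℕ} (hd : 0 < d)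
    {ρ : Fin m → ℝ} (hρ : ρ ∈ stdSimplex ℝ (Fin m))
    {πb : Fin m → Fin n → ℝ} (hπb : ∀ a, πb a ∈ stdSimplex ℝ (Fin n))
    {ψ : Fin m → Fin n → Fin d → ℝ} (hΛ : IsUnit (covMatrix ρ πb ψ)) : 0 < Lfeat ρ πb ψ := by
  have h := card_le_of_covariance (fun q : Fin m × Fin n => weight_nonneg hρ hπb q.1 q.2)
    (sum_weight hρ hπb) covMatrix_eq_sum hΛ (fun q => le_Lfeat _ _)
  rw [Fintype.card_fin] at h
  exact lt_of_lt_of_le (by exact_mod_cast hd) h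

theorem error_expansion_le {d : ℕ} {T N L K σ δ : ℝ} (hT : 1 ≤ T) (hN : 0 ≤ N)
    (hL : 0 < L) (hK : 0 ≤ K) (hσ : 0 ≤ σ) (hδ : 0 < δ) (hδ1 : δ < 1) :
    1 / √T * E1 N σ δ + 1 / T * E2 d N L K σ δ + 1 / T ^ (3 / 2 : ℝ) * E3 d N L K σ δ
        + 1 / T ^ 2 * E4 d N L σ δ ≤
      N * √(2 * σ ^ 2 * Real.log (8 / δ) / T) +
        (E2 d N L K σ δ + E3 d N L K σ δ + E4 d N L σ δ) / T := by
  have hl : 0 ≤ Real.log (16 * (d + 1) / δ) :=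
    Real.log_nonneg (by rw [le_div_iff₀ hδ]; nlinarith [(Nat.cast_nonneg d : (0 : ℝ) ≤ d)])
  have hT0 : 0 < T := by linarith
  have h3 : 0 ≤ E3 d N L K σ δ := by rw [E3]; positivity
  have h4 : 0 ≤ E4 d N L σ δ := by rw [E4]; positivity
  have h3' : 1 / T ^ (3 / 2 : ℝ) ≤ 1 / T := by
    refine one_div_le_one_div_of_le hT0 ?_
    rw [rpow_three_halves hT0.le]
    exact le_mul_of_one_le_right hT0.le (Real.one_le_sqrt.2 hT)
  have h4' : 1 / T ^ 2 ≤ 1 / T := one_div_le_one_div_of_le hT0 (by nlinarith)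
  have e1 : 1 / √T * E1 N σ δ = N * √(2 * σ ^ 2 * Real.log (8 / δ) / T) := by
    rw [E1, Real.sqrt_div' _ hT0.le]; ring
  have h3'' := mul_le_mul_of_nonneg_right h3' h3
  have h4'' := mul_le_mul_of_nonneg_right h4' h4
  rw [e1]
  have : (E2 d N L K σ δ + E3 d N L K σ δ + E4 d N L σ δ) / T =
    1 / T * E2 d N L K σ δ + 1 / T * E3 d N L K σ δ + 1 / T * E4 d N L σ δ := by ring
  linarith

end LinearBandit

theorem mainTheorem10 {m n d : ℕ} (hd : 0 < d)
    (ρ : Fin m → ℝ) (hρ : ρ ∈ stdSimplex ℝ (Fin m))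
    (πb : Fin m → Fin n → ℝ) (hπb : ∀ a, πb a ∈ stdSimplex ℝ (Fin n))
    (π : Fin m → Fin n → ℝ) (hπ : ∀ a, π a ∈ stdSimplex ℝ (Fin n))
    (ψ : Fin m → Fin n → Fin d → ℝ)
    (hΛ : IsUnit (LinearBandit.covMatrix ρ πb ψ))
    (θ : Fin d → ℝ) (σ : ℝ≥0) (δ : ℝ) (hδ : 0 < δ) (hδ1 : δ < 1)
    (Λ : Matrix (Fin d) (Fin d) ℝ) (hΛdef : Λ = LinearBandit.covMatrix ρ πb ψ)
    (N L K : ℝ) (hN : N = LinearBandit.wnorm Λ⁻¹ (LinearBandit.meanFeature ρ π ψ))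
    (hL : L = LinearBandit.Lfeat ρ πb ψ) (hK : K = LinearBandit.Lparam ψ θ) :
    (∀ (T : ℕ) (τ : ℝ) (Ω : Type*) [MeasurableSpace Ω] (P : Measure Ω) [IsProbabilityMeasure P]
        (i : Fin T → Ω → Fin m) (j : Fin T → Ω → Fin n) (r ξ : Fin T → Ω → ℝ),
        LinearBandit.IsSample ρ πb ψ θ σ P i j r ξ →
        18 * L * Real.log (8 * d / δ) ≤ T →
        0 < τ → τ ≤ L * Real.log (8 * d / δ) * LinearBandit.lambdaMin Λ →
        1 - δ ≤ P.real {ω |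
          |LinearBandit.policyValue ρ π ψ θ
              - LinearBandit.valueHat ρ π ψ τ (fun t => i t ω) (fun t => j t ω) (fun t => r t ω)|
            ≤ 1 / √(T : ℝ) * LinearBandit.E1 N σ δ
              + 1 / (T : ℝ) * LinearBandit.E2 d N L K σ δ
              + 1 / (T : ℝ) ^ (3 / 2 : ℝ) * LinearBandit.E3 d N L K σ δ
              + 1 / (T : ℝ) ^ 2 * LinearBandit.E4 d N L σ δ}) ∧
    (∃ C : ℝ, ∀ (T : ℕ) (τ : ℝ) (Ω : Type*) [MeasurableSpace Ω] (P : Measure Ω)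
        [IsProbabilityMeasure P]
        (i : Fin T → Ω → Fin m) (j : Fin T → Ω → Fin n) (r ξ : Fin T → Ω → ℝ),
        LinearBandit.IsSample ρ πb ψ θ σ P i j r ξ →
        18 * L * Real.log (8 * d / δ) ≤ T →
        0 < τ → τ ≤ L * Real.log (8 * d / δ) * LinearBandit.lambdaMin Λ →
        1 - δ ≤ P.real {ω |
          |LinearBandit.policyValue ρ π ψ θ
              - LinearBandit.valueHat ρ π ψ τ (fun t => i t ω) (fun t => j t ω) (fun t => r t ω)|
            ≤ N * √(2 * (σ : ℝ) ^ 2 * Real.log (8 / δ) / T) + C / T}) := by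
  subst hΛdef
  have hN0 : 0 ≤ N := hN ▸ Real.sqrt_nonneg _
  have hK0 : 0 ≤ K := hK ▸ LinearBandit.Lparam_nonneg
  have hL0 : 0 < L := hL ▸ LinearBandit.Lfeat_pos hd hρ hπb hΛ
  refine ⟨fun T τ Ω _ P _ i j r ξ hs hT hτ hτ' => ?_,
    LinearBandit.E2 d N L K σ δ + LinearBandit.E3 d N L K σ δ + LinearBandit.E4 d N L σ δ,
    fun T τ Ω _ P _ i j r ξ hs hT hτ hτ' => ?_⟩
  · subst hN hL hK
    exact LinearBandit.one_sub_le_measureReal_error_le hd hρ hπb hΛ hδ hδ1 hs hL0 hT hτ hτ'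
  · have hd1 : (1 : ℝ) ≤ d := by exact_mod_cast hd
    have ha0 : 0 < Real.log (8 * d / δ) := Real.log_pos (by rw [lt_div_iff₀ hδ]; linarith)
    have hT0 : (0 : ℝ) < T := lt_of_lt_of_le (by positivity) hT
    -- `T ≥ 1` lets the terms in `T^(-3/2)` and `T⁻²` be absorbed into `C / T`.
    have hT1 : (1 : ℝ) ≤ T := by exact_mod_cast Nat.one_le_iff_ne_zero.2 (by rintro rfl; simp at hT0)
    subst hN hL hK
    refine (LinearBandit.one_sub_le_measureReal_error_le (π := π) hd hρ hπb hΛ hδ hδ1 hs hL0 hT hτ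
      hτ').trans (measureReal_mono fun ω hω => ?_)
    rw [Set.mem_ofPred_eq] at hω ⊢
    exact hω.trans (LinearBandit.error_expansion_le hT1 hN0 hL0 hK0 σ.2 hδ hδ1)
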